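/- **Setting.** Let $n\ge 1$ and let $X_1,\dots,X_n$ be independent random variables, where $X_i$ takes the values $0,m_i,1$ with probabilities $1-p_i-q_i,\ p_i,\ q_i$; here $m_i\in[0,1]$, $p_i,q_i\ge 0$, $p_i+q_i\le 1$. For an ordering (permutation) $\sigma$ of $\{1,\dots,n\}$ a player observes $X_{\sigma(1)},X_{\sigma(2)},\dots$ one after the other and, after each observation, either stops and receives the value just observed or rejects it irrevocably; the reward is $0$ if all values are rejected. Let $V_\sigma$ be the largest expected reward over all (non-anticipating) stopping rules, and let $\mathrm{OPT}=\max_\sigma V_\sigma$. For a finite sequence $A=(X_{i_1},\dots,X_{i_k})$ let $V(A)=E[\max(X_{i_1},E[\max(X_{i_2},\cdots E[\max(X_{i_k},0)]\cdots)])]$, with $V(\emptyset)=0$, and let $R(A)=1-\prod_{l=1}^{k}(1-q_{i_l})$, the expected reward if a variable of $A$ is accepted exactly when it realizes its right endpoint $1$. Let $E_i=E[X_i\mid X_i>0]$ (with $E_i=0$ if $X_i=0$ almost surely). For $\varepsilon\in(0,1)$ put $$\mathrm{MAX}=\tfrac12E[\max(X_1,\dots,X_n)],\qquad \rho=1-\frac{\varepsilon}{2n}.$$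 **Algorithm.** Renumber the variables so that $E_1\le\dots\le E_n$. Start with $\mathcal L^0=\{(\emptyset,\emptyset)\}$. For $k=1,\dots,n$, let $\mathcal L$ consist of the two pairs $(\{X_k,S\},T)$ and $(S,\{X_k,T\})$ for each $(S,T)\in\mathcal L^{k-1}$ (where $\{X_k,A\}$ is the sequence $A$ with $X_k$ put in front), and obtain $\mathcal L^k$ from $\mathcal L$ by trimming, as follows. Let $\mathit{max}=\max_{(S,T)\in\mathcal L}V(T)$, let $\mathcal B_0=\{(S,T)\in\mathcal L:T=\emptyset\}$, and for each $j\ge1$ with $\rho^{j}\,\mathit{max}\ge\frac{\varepsilon}{2n}\mathrm{MAX}$ let $$\mathcal B_j=\{(S,T)\in\mathcal L:\ \rho^{j}\,\mathit{max}<V(T)\le\rho^{j-1}\,\mathit{max}\}.$$ Keep from each non-empty bucket $\mathcal B_j$ one pair $(S,T)$ with $R(S)$ largest in the bucket (ties broken arbitrarily), and discard all other pairs. Finally return the ordering $\sigma$ of the variables given by the sequence $(S,T)$ (first $S$, then $T$) for a pair $(S,T)\in\mathcal L^n$ with $V(S,T)$ largest. **Theorem.** Every ordering $\sigma$ that the algorithm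 can return satisfies $V_\sigma\ge(1-\varepsilon)\,\mathrm{OPT}$. Moreover, the algorithm can be implemented in the unit-cost real-number model (each arithmetic operation, maximum or comparison of real numbers and each elementary list operation costs one step) by an explicit program that runs in $O(n^4/\varepsilon^2)$ steps, with an absolute constant; the count includes sorting the variables, computing $\mathrm{MAX}$ and choosing the final pair. -/

import Mathlib

namespace OptimalOrdering

noncomputable section

/-! ## The optimal ordering problem -/

/-- The parameters of a random variable that takes the values `0`, `m`, `1` with probabilities
`1 - p - q`, `p`, `q`, respectively. -/
structure ThreePoint where
  m : ℝ
  p : ℝ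
  q : ℝ
  m_nonneg : 0 ≤ m
  m_le_one : m ≤ 1
  p_nonneg : 0 ≤ p
  q_nonneg : 0 ≤ q
  p_add_q_le_one : p + q ≤ 1

/-- The three values of the variable. -/
def ThreePoint.val (Y : ThreePoint) : Fin 3 → ℝ := ![0, Y.m, 1]

/-- The probabilities of the three values. -/
def ThreePoint.prob (Y : ThreePoint) : Fin 3 → ℝ := ![1 - Y.p - Y.q, Y.p, Y.q]

/-- `E[Y | Y > 0]` (it is `0 / 0 = 0` if `Y = 0` almost surely). -/
def ThreePoint.condMean (Y : ThreePoint) : ℝ :=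
  (∑ j, if 0 < Y.val j then Y.prob j * Y.val j else 0) /
    (∑ j, if 0 < Y.val j then Y.prob j else 0)

/-- `E[max (Y, v)]` for a constant `v`. -/
def ThreePoint.expMax (Y : ThreePoint) (v : ℝ) : ℝ :=
  ∑ j, Y.prob j * max (Y.val j) v

variable {n : ℕ}

/-- The expectation of `f (X 0, …, X (n - 1))` for independent variables `X i`. -/
def expect (X : Fin n → ThreePoint) (f : (Fin n → ℝ) → ℝ) : ℝ :=
  ∑ ω : Fin n → Fin 3, (∏ i, (X i).prob (ω i)) * f (fun i => (X i).val (ω i))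

/-- A (non-anticipating) stopping rule: it is shown the list of all values observed so far, the
latest one first, and says whether to stop and accept the latest value. -/
abbrev StoppingRule : Type := List ℝ → Bool

/-- The reward of the stopping rule `r` when the values `xs` are still to come and the values `hist`
(latest first) have been observed and rejected.  If no value is accepted the reward is `0`. -/
def stoppedReward (r : StoppingRule) : (hist xs : List ℝ) → ℝ
  | _, [] => 0
  | hist, x :: xs => if r (x :: hist) then x else stoppedReward r (x :: hist) xs

/-- `V_σ`: the expected reward under an optimal stopping rule, when the variables are probed in the
order `X (σ 0), X (σ 1), …`. -/
def orderValue (X : Fin n → ThreePoint) (σ : Equiv.Perm (Fin n)) : ℝ :=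
  ⨆ r : StoppingRule, expect X fun x => stoppedReward r [] (List.ofFn fun t => x (σ t))

/-- `OPT`: the largest `V_σ` over all orderings `σ`. -/
def optValue (X : Fin n → ThreePoint) : ℝ :=
  ⨆ σ : Equiv.Perm (Fin n), orderValue X σ

/-! ## The algorithm as a mathematical procedure -/

/-- The dynamic programming value `V(A) = E[max(X_{i₁}, E[max(X_{i₂}, ⋯ E[max(X_{i_k}, 0)] ⋯ )])]`
of a sequence `A = (X_{i₁}, …, X_{i_k})`, with `V(∅) = 0`. -/
def seqValue (X : Fin n → ThreePoint) : List (Fin n) → ℝ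
  | [] => 0
  | i :: A => (X i).expMax (seqValue X A)

/-- The value of a first part `S` of an ordered partition `(S, T)`.  A variable in `S` is accepted if
and only if it realizes its right endpoint `1`, so this is the expected reward collected from `S` by
that rule, that is, `1 - ∏_{i ∈ S} (1 - q_i)`. -/
def firstValue (X : Fin n → ThreePoint) : List (Fin n) → ℝ
  | [] => 0
  | i :: S => (X i).q * 1 + (1 - (X i).q) * firstValue X S

/-- Pairs `(S, T)` of sequences of variables, given by their indices. -/
abbrev SeqPair (n : ℕ) : Type := List (Fin n) × List (Fin n)

/-- From each `(S, T)` in `L` form the two pairs `({X_k, S}, T)` and `(S, {X_k, T})`. -/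
def expand (k : Fin n) (L : Set (SeqPair n)) : Set (SeqPair n) :=
  {P | ∃ Q ∈ L, P = (k :: Q.1, Q.2) ∨ P = (Q.1, k :: Q.2)}

/-- The quantity `MAX = E[max(X_1, …, X_n)] / 2`. -/
def maxParam (X : Fin n → ThreePoint) : ℝ :=
  (expect X fun x => ⨆ i, x i) / 2

/-- The grid ratio `ρ = 1 - ε / (2 n)`. -/
def gridRatio (n : ℕ) (ε : ℝ) : ℝ := 1 - ε / (2 * n)

/-- The threshold `(ε / (2 n)) MAX`. -/
def threshold (X : Fin n → ThreePoint) (ε : ℝ) : ℝ := ε / (2 * n) * maxParam X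

/-- `max = max_{(S, T) ∈ L} V(T)`. -/
def maxValue (X : Fin n → ThreePoint) (L : Set (SeqPair n)) : ℝ :=
  sSup ((fun P : SeqPair n => seqValue X P.2) '' L)

/-- The buckets of TRIM.  `B_0` holds the pairs with `T = ∅`.  For `1 ≤ j ≤ J`, `B_j` holds the pairs
with `ρ ^ j * max < V(T) ≤ ρ ^ (j - 1) * max`.  Here `J` is the largest `j` with
`ρ ^ j * max ≥ (ε / (2 n)) MAX`, so that `j ≤ J` is expressed by this inequality; a bucket with
`j > J` is empty. -/
def bucket (X : Fin n → ThreePoint) (ε : ℝ) (L : Set (SeqPair n)) : ℕ → Set (SeqPair n)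
  | 0 => {P ∈ L | P.2 = []}
  | j + 1 => {P ∈ L | threshold X ε ≤ gridRatio n ε ^ (j + 1) * maxValue X L ∧
      gridRatio n ε ^ (j + 1) * maxValue X L < seqValue X P.2 ∧
      seqValue X P.2 ≤ gridRatio n ε ^ j * maxValue X L}

/-- `L'` is a possible result of TRIM on `L`: it holds, for each non-empty bucket, one member of the
bucket for which the value of `S` is largest in the bucket (ties are broken arbitrarily). -/
def IsTrim (X : Fin n → ThreePoint) (ε : ℝ) (L L' : Set (SeqPair n)) : Prop :=
  ∃ c : ℕ → SeqPair n,
    (∀ j, (bucket X ε L j).Nonempty →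
      c j ∈ bucket X ε L j ∧ ∀ P ∈ bucket X ε L j, firstValue X P.1 ≤ firstValue X (c j).1) ∧
    L' = {P | ∃ j, (bucket X ε L j).Nonempty ∧ P = c j}

/-- `L 0, …, L n` are the collections of pairs in a run of the algorithm, in which the variables are
processed in the order `X (π 0), X (π 1), …`, sorted by increasing `E[X_i | X_i > 0]`. -/
structure IsRun (X : Fin n → ThreePoint) (ε : ℝ) (π : Equiv.Perm (Fin n))
    (L : ℕ → Set (SeqPair n)) : Prop where
  sorted : Monotone fun k => (X (π k)).condMean
  init : L 0 = {([], [])}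
  trim : ∀ k : Fin n, IsTrim X ε (expand (π k) (L k)) (L (k + 1))

/-- `σ` is the ordering found in some run of the algorithm: the concatenation of a pair `(S, T)` in
the final collection for which `V(S, T)` is largest. -/
def IsOutput (X : Fin n → ThreePoint) (ε : ℝ) (σ : Equiv.Perm (Fin n)) : Prop :=
  ∃ (π : Equiv.Perm (Fin n)) (L : ℕ → Set (SeqPair n)), IsRun X ε π L ∧
    ∃ P ∈ L n, List.ofFn σ = P.1 ++ P.2 ∧
      ∀ Q ∈ L n, seqValue X (Q.1 ++ Q.2) ≤ seqValue X (P.1 ++ P.2)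

/-! ## Step counting

Unit-cost real-number model: every arithmetic operation, maximum or comparison of real numbers takes
one step, and so does every call of a recursive function, which covers a bounded number of list-cell
and record accesses.  Real numbers are processed only through the primitives below. -/

/-- A result together with the number of steps taken to obtain it. -/
structure Timed (α : Type) where
  ret : α
  time : ℕ

instance : Monad Timed where
  pure a := ⟨a, 0⟩
  bind x f := ⟨(f x.ret).ret, x.time + (f x.ret).time⟩

/-- One step without a result. -/
def tick : Timed Unit := ⟨(), 1⟩

def radd (x y : ℝ) : Timed ℝ := ⟨x + y, 1⟩
def rsub (x y : ℝ) : Timed ℝ := ⟨x - y, 1⟩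
def rmul (x y : ℝ) : Timed ℝ := ⟨x * y, 1⟩
def rdiv (x y : ℝ) : Timed ℝ := ⟨x / y, 1⟩
def rmax (x y : ℝ) : Timed ℝ := ⟨max x y, 1⟩
open Classical in
def rle (x y : ℝ) : Timed Bool := ⟨decide (x ≤ y), 1⟩

/-! ## The algorithm as a program -/

/-- Apply `f` to all members of a list. -/
def mapT {α β : Type} (f : α → Timed β) : List α → Timed (List β)
  | [] => do tick; return []
  | a :: l => do
    tick
    let b ← f a
    let l' ← mapT f l
    return b :: l'

/-- Concatenate two lists. -/
def appendT {α : Type} : List α → List α → Timed (List α)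
  | [], l' => do tick; return l'
  | a :: l, l' => do
    tick
    let r ← appendT l l'
    return a :: r

/-- Insert into a list with increasing keys. -/
def insertT {α : Type} (a : ℝ × α) : List (ℝ × α) → Timed (List (ℝ × α))
  | [] => do tick; return [a]
  | b :: l => do
    tick
    if (← rle a.1 b.1) then
      return a :: b :: l
    else
      let r ← insertT a l
      return b :: r

/-- Insertion sort by increasing keys. -/
def sortT {α : Type} : List (ℝ × α) → Timed (List (ℝ × α))
  | [] => do tick; return []
  | a :: l => do
    tick
    let r ← sortT l
    insertT a r

/-- Sort a list by increasing values of `key`. -/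
def sortByT {α : Type} (key : α → Timed ℝ) (l : List α) : Timed (List α) := do
  let keyed ← mapT (fun a => do let e ← key a; return (e, a)) l
  let sorted ← sortT keyed
  mapT (fun x => do return x.2) sorted

/-- `E[Y | Y > 0]`. -/
def condMeanT (Y : ThreePoint) : Timed ℝ := do
  let a ← rmul Y.p Y.m
  let num ← radd a Y.q
  let den ← if (← rle Y.m 0) then pure Y.q else radd Y.p Y.q
  if (← rle den 0) then return 0 else rdiv num den

/-- `E[max (Y, v)]`. -/
def expMaxT (Y : ThreePoint) (v : ℝ) : Timed ℝ := do
  let u ← rsub 1 Y.p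
  let u ← rsub u Y.q
  let a ← rmax 0 v
  let a ← rmul u a
  let b ← rmax Y.m v
  let b ← rmul Y.p b
  let c ← rmax 1 v
  let c ← rmul Y.q c
  let s ← radd a b
  radd s c

/-- For variables listed by increasing `m`: among the variables processed so far, `P` is the
probability that none is at its right endpoint, and `G` is the expectation of their maximum on that
event.  The result is the expected maximum of all variables. -/
def expectMaxT (X : Fin n → ThreePoint) : List (Fin n) → (P G : ℝ) → Timed ℝ
  | [], P, G => do
    tick
    let a ← rsub 1 P
    radd a G
  | i :: l, P, G => do
    tick
    let a ← rmul (X i).p (X i).m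
    let a ← rmul a P
    let u ← rsub 1 (X i).p
    let u ← rsub u (X i).q
    let b ← rmul u G
    let G' ← radd a b
    let w ← rsub 1 (X i).q
    let P' ← rmul w P
    expectMaxT X l P' G'

/-- `MAX = E[max(X_1, …, X_n)] / 2`. -/
def maxParamT (X : Fin n → ThreePoint) : Timed ℝ := do
  let l ← sortByT (fun i => do return (X i).m) (List.finRange n)
  let e ← expectMaxT X l 1 0
  rdiv e 2

/-- A pair `(S, T)`, stored with the value `s` of `S` and the value `v = V(T)` of `T`. -/
structure Node (n : ℕ) where
  S : List (Fin n)
  T : List (Fin n)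
  s : ℝ
  v : ℝ

/-- `({X_i, S}, T)`. -/
def pushS (X : Fin n → ThreePoint) (i : Fin n) (N : Node n) : Timed (Node n) := do
  let a ← rmul (X i).q 1
  let u ← rsub 1 (X i).q
  let b ← rmul u N.s
  let s ← radd a b
  return ⟨i :: N.S, N.T, s, N.v⟩

/-- `(S, {X_i, T})`. -/
def pushT (X : Fin n → ThreePoint) (i : Fin n) (N : Node n) : Timed (Node n) := do
  let v ← expMaxT (X i) N.v
  return ⟨N.S, i :: N.T, N.s, v⟩

/-- Merge two lists that are sorted by decreasing `v`. -/
def mergeT : List (Node n) → List (Node n) → Timed (List (Node n))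
  | [], B => do tick; return B
  | A, [] => do tick; return A
  | a :: A, b :: B => do
    tick
    if (← rle b.v a.v) then
      let r ← mergeT A (b :: B)
      return a :: r
    else
      let r ← mergeT (a :: A) B
      return b :: r
termination_by A B => A.length + B.length

/-- The maximum of `mx` and all values `v` in the list. -/
def maxT : List (Node n) → (mx : ℝ) → Timed ℝ
  | [], mx => do tick; return mx
  | N :: l, mx => do
    tick
    let mx' ← rmax mx N.v
    maxT l mx'

/-- The list of all `x, ρ * x, ρ ^ 2 * x, …` that are at least `θ`.  It is empty if `θ ≤ 0` or if
`0 < ρ < 1` fails.  The four comparisons and the multiplication by `ρ` are charged together with the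
call. -/
def gridT (ρ θ x : ℝ) : Timed (List ℝ) :=
  open Classical in
  if h : 0 < θ ∧ 0 < ρ ∧ ρ < 1 ∧ θ ≤ x then
    ⟨x :: (gridT ρ θ (ρ * x)).ret, 6 + (gridT ρ θ (ρ * x)).time⟩
  else
    ⟨[], 5⟩
termination_by ⌊Real.log (x / θ) / (-Real.log ρ) + 1⌋₊
decreasing_by
  all_goals
    obtain ⟨hθ, hρ, hρ1, hx⟩ := h
    have hx0 : 0 < x := lt_of_lt_of_le hθ hx
    have hl : 0 < -Real.log ρ := neg_pos.mpr (Real.log_neg hρ hρ1)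
    have h1 : Real.log (ρ * x / θ) / (-Real.log ρ) + 1 = Real.log (x / θ) / (-Real.log ρ) := by
      rw [mul_div_assoc, Real.log_mul hρ.ne' (div_pos hx0 hθ).ne', add_div,
        div_neg, div_self (neg_pos.mp hl).ne]
      ring
    have h2 : 0 ≤ Real.log (x / θ) / (-Real.log ρ) :=
      div_nonneg (Real.log_nonneg ((one_le_div hθ).mpr hx)) hl.le
    rw [h1, Nat.floor_add_one h2]
    exact Nat.lt_succ_self _

/-- The better of two candidates, as measured by the value `s`. -/
def betterT (best : Option (Node n)) (N : Node n) : Timed (Node n) :=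
  match best with
  | none => do tick; return N
  | some M => do if (← rle N.s M.s) then return M else return N

/-- Split off the initial part with `v > g` of a list that is sorted by decreasing `v`: return its
best member and the rest of the list. -/
def takeBucketT (g : ℝ) : Option (Node n) → List (Node n) →
    Timed (Option (Node n) × List (Node n))
  | best, [] => do tick; return (best, [])
  | best, N :: l => do
    tick
    if (← rle N.v g) then
      return (best, N :: l)
    else
      let M ← betterT best N
      takeBucketT g (some M) l

/-- The best members of the buckets `B_1, …, B_J`, whose lower ends are listed in `grid`, followed by
`tail`. -/
def bucketsT (tail : List (Node n)) : (grid : List ℝ) → List (Node n) → Timed (List (Node n))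
  | [], _ => do tick; return tail
  | g :: grid, l => do
    tick
    let r ← takeBucketT g none l
    let out ← bucketsT tail grid r.2
    match r.1 with
    | none => return out
    | some N => return N :: out

/-- The best member of the bucket `B_0`, as a list. -/
def emptyBucketT : Option (Node n) → List (Node n) → Timed (List (Node n))
  | none, [] => do tick; return []
  | some M, [] => do tick; return [M]
  | best, N :: l => do
    tick
    match N.T with
    | [] =>
      let M ← betterT best N
      emptyBucketT (some M) l
    | _ :: _ => emptyBucketT best l

/-- TRIM for a list that is sorted by decreasing `v`. -/
def trimT (ρ θ : ℝ) (l : List (Node n)) : Timed (List (Node n)) := do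
  let mx ← maxT l 0
  let x ← rmul ρ mx
  let grid ← gridT ρ θ x
  let b ← emptyBucketT none l
  bucketsT b grid l

/-- The main loop. -/
def loopT (X : Fin n → ThreePoint) (ρ θ : ℝ) : List (Fin n) → List (Node n) →
    Timed (List (Node n))
  | [], L => do tick; return L
  | k :: ks, L => do
    tick
    let A ← mapT (pushS X k) L
    let B ← mapT (pushT X k) L
    let M ← mergeT A B
    let L' ← trimT ρ θ M
    loopT X ρ θ ks L'

/-- The value of a sequence of variables followed by the constant `v`. -/
def valueFromT (X : Fin n → ThreePoint) : List (Fin n) → (v : ℝ) → Timed ℝ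
  | [], v => do tick; return v
  | i :: l, v => do
    tick
    let w ← valueFromT X l v
    expMaxT (X i) w

/-- The pair `(S, T)` with the largest `V(S, T)` in the list, if it exceeds the value `best.1` of the
pair `best.2` found so far. -/
def bestT (X : Fin n → ThreePoint) : (best : ℝ × SeqPair n) → List (Node n) →
    Timed (SeqPair n)
  | best, [] => do tick; return best.2
  | best, N :: l => do
    tick
    let w ← valueFromT X N.S N.v
    if (← rle w best.1) then
      bestT X best l
    else
      bestT X (w, (N.S, N.T)) l

/-- The whole algorithm: sort the variables, compute `MAX`, `ρ` and the threshold, run the main loop,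
and return the ordering given by the best pair in the final collection. -/
def fptas (X : Fin n → ThreePoint) (ε : ℝ) : Timed (List (Fin n)) := do
  let order ← sortByT (fun i => condMeanT (X i)) (List.finRange n)
  let mx ← maxParamT X
  let d ← rmul 2 n
  let δ ← rdiv ε d
  let ρ ← rsub 1 δ
  let θ ← rmul δ mx
  let L ← loopT X ρ θ order [⟨[], [], 0, 0⟩]
  let P ← bestT X (-1, ([], [])) L
  appendT P.1 P.2

end

end OptimalOrdering

open OptimalOrdering

namespace OptimalOrdering

variable {n : ℕ}

/-! ## Elementary facts about three-point variables -/

/-! Approximation. Backward induction identifies `V_σ` with the nested expectation `seqValue` along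
`σ` (`orderValue_eq`). With continuation value `v ∈ [0, 1]`, an optimal rule treats each variable in
one of two ways: it accepts only the value `1`, or it accepts every positive value
(`expMax_eq_stage`). Once these modes are fixed, each variable acts on `v` as an affine map `e + (1
- r) v`, and the adjacent exchange argument shows that a product of such stages is largest when `e /
r` decreases. The ratio is `1` in the first mode and `E_i ≤ 1` in the second. Hence every ordering
is dominated by some pair `(S, T)`, with `T` in the order of decreasing `E_i`, through the bound
`R(S) + (1 - R(S)) V(T)` (`exists_partition`). Conversely `V(S, T)` is at least this expression
(`le_seqValue_append`). Since `V(T) ≤ 1`, the expression increases in both `R(S)` and `V(T)`, so it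
suffices to keep, for each approximate value of `V(T)`, a pair with the largest `R(S)`.

One trimming step loses at most a factor `ρ` in `V(T)` and an additive threshold `θ = (ε / 2n) MAX`;
values too small for the grid are replaced by the pair from `B_0`. The map `v ↦ E[max(X_i, v)]` does
not amplify an error of this form (`mul_expMax_sub_le`). After `n` steps the factor is `ρ ^ n ≥ 1 -
ε / 2` by Bernoulli and the additive loss is `n θ = (ε / 2) MAX`. The prophet inequality
`listExpect_max_le` gives `MAX ≤ V_σ` for every `σ`, so both losses together are at most `ε OPT`.

Running time. Each `V(T)` is at most `2 MAX`, so the grid from `max` down to `θ` has at most `8 n² /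
ε²` points (`gridT_length_le`). The lists stay sorted by `V(T)` because `E[max(X_k, ·)]` is
monotone; an iteration therefore needs only a merge and a linear scan. The `n` iterations and the
final evaluation each cost `O(n³ / ε²)`, which is within the claimed bound.

Correctness of the program is the statement that its lists, read as sets of pairs, form a run in the
sense of `IsRun` (`isRun_nodesAt`). -/

theorem ThreePoint.prob_nonneg (Y : ThreePoint) (j : Fin 3) : 0 ≤ Y.prob j := by
  have h1 := Y.p_nonneg
  have h2 := Y.q_nonneg
  have h3 := Y.p_add_q_le_one
  fin_cases j <;> simp [ThreePoint.prob] <;> linarith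

theorem ThreePoint.sum_prob (Y : ThreePoint) : ∑ j, Y.prob j = 1 := by
  simp [ThreePoint.prob, Fin.sum_univ_three]
  ring

theorem ThreePoint.val_nonneg (Y : ThreePoint) (j : Fin 3) : 0 ≤ Y.val j := by
  have := Y.m_nonneg
  fin_cases j <;> simp [ThreePoint.val, this]

theorem ThreePoint.val_le_one (Y : ThreePoint) (j : Fin 3) : Y.val j ≤ 1 := by
  have := Y.m_le_one
  fin_cases j <;> simp [ThreePoint.val, this]

theorem ThreePoint.expMax_eq (Y : ThreePoint) (v : ℝ) :
    Y.expMax v = (1 - Y.p - Y.q) * max 0 v + Y.p * max Y.m v + Y.q * max 1 v := by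
  simp [ThreePoint.expMax, ThreePoint.prob, ThreePoint.val, Fin.sum_univ_three]

theorem ThreePoint.sum_prob_mul_le (Y : ThreePoint) {f g : Fin 3 → ℝ} (h : ∀ j, f j ≤ g j) :
    ∑ j, Y.prob j * f j ≤ ∑ j, Y.prob j * g j :=
  Finset.sum_le_sum fun j _ => mul_le_mul_of_nonneg_left (h j) (Y.prob_nonneg j)

theorem ThreePoint.sum_prob_mul_const (Y : ThreePoint) (c : ℝ) : ∑ j, Y.prob j * c = c := by
  rw [← Finset.sum_mul, Y.sum_prob, one_mul]

theorem ThreePoint.expMax_mono (Y : ThreePoint) : Monotone Y.expMax :=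
  fun _ _ h => Y.sum_prob_mul_le fun _ => max_le_max le_rfl h

theorem ThreePoint.le_expMax (Y : ThreePoint) (v : ℝ) : v ≤ Y.expMax v := by
  calc v = ∑ j, Y.prob j * v := (Y.sum_prob_mul_const v).symm
    _ ≤ _ := Y.sum_prob_mul_le fun _ => le_max_right _ _

theorem ThreePoint.expMax_le_one (Y : ThreePoint) {v : ℝ} (hv : v ≤ 1) : Y.expMax v ≤ 1 := by
  calc Y.expMax v ≤ ∑ j, Y.prob j * 1 := Y.sum_prob_mul_le fun j => max_le (Y.val_le_one j) hv
    _ = 1 := Y.sum_prob_mul_const 1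

/-- This is how an error with a multiplicative and an additive part passes through one step of the
dynamic program. It holds outcome by outcome: if the realized value `x` is below `w`, the hypothesis
applies, and otherwise `ρ x - e ≤ x` because `x ≥ 0`. -/
theorem ThreePoint.mul_expMax_sub_le (Y : ThreePoint) {ρ e v w : ℝ} (h1 : ρ ≤ 1)
    (he : 0 ≤ e) (h : ρ * w - e ≤ v) : ρ * Y.expMax w - e ≤ Y.expMax v := by
  calc ρ * Y.expMax w - e = ∑ j, Y.prob j * (ρ * max (Y.val j) w - e) := by
        simp only [mul_sub, Finset.sum_sub_distrib, Y.sum_prob_mul_const e, ThreePoint.expMax,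
          Finset.mul_sum]
        congr 1
        exact Finset.sum_congr rfl fun j _ => by ring
    _ ≤ _ := by
      refine Y.sum_prob_mul_le fun j => ?_
      have hx := Y.val_nonneg j
      rcases le_total (Y.val j) w with hw | hw
      · rw [max_eq_right hw]
        exact h.trans (le_max_right _ _)
      · rw [max_eq_left hw]
        exact le_trans (by nlinarith) (le_max_left _ _)

theorem seqValue_nonneg (X : Fin n → ThreePoint) (l : List (Fin n)) : 0 ≤ seqValue X l := by
  induction l with
  | nil => exact le_rfl
  | cons i l ih => exact ih.trans ((X i).le_expMax _)

theorem seqValue_le_one (X : Fin n → ThreePoint) (l : List (Fin n)) : seqValue X l ≤ 1 := by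
  induction l with
  | nil => exact zero_le_one
  | cons i l ih => exact (X i).expMax_le_one ih

theorem firstValue_cons (X : Fin n → ThreePoint) (i : Fin n) (l : List (Fin n)) :
    firstValue X (i :: l) = (X i).q + (1 - (X i).q) * firstValue X l := by
  simp [firstValue]

theorem ThreePoint.q_le_one (Y : ThreePoint) : Y.q ≤ 1 := by
  linarith [Y.p_nonneg, Y.p_add_q_le_one]

theorem firstValue_mem (X : Fin n → ThreePoint) (l : List (Fin n)) :
    0 ≤ firstValue X l ∧ firstValue X l ≤ 1 := by
  induction l with
  | nil => exact ⟨le_rfl, zero_le_one⟩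
  | cons i l ih =>
    rw [firstValue_cons]
    have := (X i).q_nonneg
    have := (X i).q_le_one
    constructor <;> nlinarith

theorem firstValue_cons_le (X : Fin n → ThreePoint) (i : Fin n) {l l' : List (Fin n)}
    (h : firstValue X l ≤ firstValue X l') :
    firstValue X (i :: l) ≤ firstValue X (i :: l') := by
  rw [firstValue_cons, firstValue_cons]
  have := (X i).q_le_one
  nlinarith

theorem firstValue_le_cons (X : Fin n → ThreePoint) (i : Fin n) (l : List (Fin n)) :
    firstValue X l ≤ firstValue X (i :: l) := by
  rw [firstValue_cons]
  have := (X i).q_nonneg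
  have := (firstValue_mem X l).2
  nlinarith

/-! ## Expectations over lists of independent variables -/

/-- The expectation of `f` of the list of realizations of independent variables. -/
noncomputable def listExpect : List ThreePoint → (List ℝ → ℝ) → ℝ
  | [], f => f []
  | Y :: l, f => ∑ j, Y.prob j * listExpect l fun xs => f (Y.val j :: xs)

/-- Splitting off the first coordinate turns the sum over all outcomes into nested sums, which match
the head recursion of `stoppedReward`, `seqValue` and `listMax`. -/
theorem expect_ofFn {n : ℕ} (Y : Fin n → ThreePoint) (f : List ℝ → ℝ) :
    expect Y (fun x => f (List.ofFn x)) = listExpect (List.ofFn Y) f := by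
  induction n generalizing f with
  | zero => simp [expect, listExpect]
  | succ n ih =>
    rw [List.ofFn_succ, listExpect]
    simp_rw [← ih]
    unfold expect
    rw [← (Fin.consEquiv fun _ : Fin (n + 1) => Fin 3).sum_comp, Fintype.sum_prod_type]
    refine Finset.sum_congr rfl fun j _ => ?_
    rw [Finset.mul_sum]
    refine Finset.sum_congr rfl fun ω _ => ?_
    simp [Fin.consEquiv, Fin.prod_univ_succ, List.ofFn_succ, mul_assoc]

theorem expect_comp_perm (X : Fin n → ThreePoint) (σ : Equiv.Perm (Fin n))
    (f : (Fin n → ℝ) → ℝ) :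
    expect X (fun x => f fun t => x (σ t)) = expect (fun t => X (σ t)) f := by
  unfold expect
  rw [← (Equiv.arrowCongr σ (Equiv.refl (Fin 3))).sum_comp]
  refine Finset.sum_congr rfl fun ω _ => ?_
  rw [← Equiv.prod_comp σ]
  simp [Equiv.arrowCongr]

theorem expect_perm (X : Fin n → ThreePoint) (σ : Equiv.Perm (Fin n)) (f : List ℝ → ℝ) :
    expect X (fun x => f (List.ofFn fun t => x (σ t))) =
      listExpect ((List.ofFn σ).map X) f := by
  rw [expect_comp_perm X σ fun x => f (List.ofFn x), expect_ofFn, List.map_ofFn]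
  rfl

theorem listExpect_mono (l : List ThreePoint) {f g : List ℝ → ℝ} (h : ∀ xs, f xs ≤ g xs) :
    listExpect l f ≤ listExpect l g := by
  induction l generalizing f g with
  | nil => exact h []
  | cons Y l ih => exact Y.sum_prob_mul_le fun j => ih fun xs => h _

theorem listExpect_const (l : List ThreePoint) (c : ℝ) : listExpect l (fun _ => c) = c := by
  induction l with
  | nil => rfl
  | cons Y l ih => simp only [listExpect, ih, Y.sum_prob_mul_const]

/-! ## The value of an ordering -/

/-- Backward induction: stopping yields the current value and continuing yields at most `V` of the
remaining sequence, whatever the history. -/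
theorem listExpect_stoppedReward_le (X : Fin n → ThreePoint) (r : StoppingRule)
    (l : List (Fin n)) (hist : List ℝ) :
    listExpect (l.map X) (stoppedReward r hist) ≤ seqValue X l := by
  induction l generalizing hist with
  | nil => simp [listExpect, stoppedReward, seqValue]
  | cons i l ih =>
    rw [List.map_cons, listExpect, seqValue, ThreePoint.expMax]
    refine (X i).sum_prob_mul_le fun j => ?_
    by_cases h : r ((X i).val j :: hist) = true
    · simp only [stoppedReward, h, if_true, listExpect_const]
      exact le_max_left _ _
    · simp only [stoppedReward, h]
      exact (ih _).trans (le_max_right _ _)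

-- An optimal rule needs only the latest value and the number of observations. The length of the
-- history serves as a clock, so `k` is part of the induction: at length `k + 1` the new rule
-- compares the latest value with the continuation value, and at other lengths it defers to the rule
-- for the tail.
open Classical in
theorem exists_rule (X : Fin n → ThreePoint) (l : List (Fin n)) (k : ℕ) :
    ∃ r : StoppingRule, ∀ hist : List ℝ, hist.length = k →
      listExpect (l.map X) (stoppedReward r hist) = seqValue X l := by
  induction l generalizing k with
  | nil => exact ⟨fun _ => true, fun _ _ => rfl⟩
  | cons i l ih =>
    obtain ⟨r, hr⟩ := ih (k + 1)
    -- From a given history onwards the reward consults the rule only on strictly longer histories,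
    -- so changing the rule at length `k + 1` does not affect the tail.
    have key : ∀ (s : StoppingRule), (∀ h : List ℝ, k + 1 < h.length → s h = r h) →
        ∀ (l : List ThreePoint) (h : List ℝ), k + 1 ≤ h.length →
        listExpect l (stoppedReward s h) = listExpect l (stoppedReward r h) := by
      intro s hs l
      induction l with
      | nil => intro h _; rfl
      | cons Y l ih' =>
        intro h hh
        rw [listExpect, listExpect]
        refine Finset.sum_congr rfl fun j _ => ?_
        have h1 : s (Y.val j :: h) = r (Y.val j :: h) := hs _ (by simp; omega)
        simp only [stoppedReward, h1]
        by_cases h2 : r (Y.val j :: h) = true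
        · simp only [h2, if_true]
        · simp only [h2]
          have := ih' (Y.val j :: h) (by simp; omega)
          simpa using congrArg (Y.prob j * ·) this
    refine ⟨fun h => if h.length = k + 1 then decide (seqValue X l ≤ h.headD 0) else r h, ?_⟩
    intro hist hk
    rw [List.map_cons, listExpect, seqValue, ThreePoint.expMax]
    refine Finset.sum_congr rfl fun j _ => ?_
    congr 1
    by_cases h : seqValue X l ≤ (X i).val j
    · simp [stoppedReward, hk, h, listExpect_const]
    · simp only [stoppedReward, List.length_cons, hk, if_true, List.headD_cons, h, decide_false]
      rw [max_eq_right (le_of_not_ge h)]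
      refine Eq.trans ?_ (hr ((X i).val j :: hist) (by simp [hk]))
      refine key _ ?_ _ _ (by simp [hk])
      intro h' hh'
      rw [if_neg (by omega)]

theorem orderValue_eq (X : Fin n → ThreePoint) (σ : Equiv.Perm (Fin n)) :
    orderValue X σ = seqValue X (List.ofFn σ) := by
  unfold orderValue
  simp_rw [expect_perm X σ]
  obtain ⟨r, hr⟩ := exists_rule X (List.ofFn σ) 0
  have hle : ∀ r : StoppingRule, listExpect ((List.ofFn σ).map X) (stoppedReward r []) ≤
    seqValue X (List.ofFn σ) := fun r => listExpect_stoppedReward_le X r _ _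
  refine le_antisymm (ciSup_le hle) ?_
  rw [← hr [] rfl]
  exact le_ciSup ⟨seqValue X (List.ofFn σ), by rintro _ ⟨r, rfl⟩; exact hle r⟩ r

/-! ## The expected maximum -/

/-- The maximum of `0` and the members of a list. -/
noncomputable def listMax (xs : List ℝ) : ℝ := xs.foldr max 0

@[simp] theorem listMax_nil : listMax [] = 0 := rfl

@[simp] theorem listMax_cons (x : ℝ) (xs : List ℝ) : listMax (x :: xs) = max x (listMax xs) := rfl

theorem listMax_nonneg (xs : List ℝ) : 0 ≤ listMax xs := by
  induction xs with
  | nil => exact le_rfl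
  | cons x xs ih => exact ih.trans (le_max_right _ _)

theorem le_listMax {xs : List ℝ} {x : ℝ} (h : x ∈ xs) : x ≤ listMax xs := by
  induction xs with
  | nil => simp at h
  | cons y xs ih =>
    rcases List.mem_cons.1 h with rfl | h
    · exact le_max_left _ _
    · exact (ih h).trans (le_max_right _ _)

theorem listMax_le {xs : List ℝ} {c : ℝ} (h0 : 0 ≤ c) (h : ∀ x ∈ xs, x ≤ c) : listMax xs ≤ c := by
  induction xs with
  | nil => exact h0
  | cons y xs ih =>
    exact max_le (h y (by simp)) (ih fun x hx => h x (by simp [hx]))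

theorem listMax_ofFn_perm (hn : 1 ≤ n) (x : Fin n → ℝ) (hx : ∀ i, 0 ≤ x i)
    (σ : Equiv.Perm (Fin n)) : ⨆ i, x i = listMax (List.ofFn fun t => x (σ t)) := by
  have : Nonempty (Fin n) := ⟨⟨0, hn⟩⟩
  refine le_antisymm (ciSup_le fun i => le_listMax ?_) (listMax_le (Real.iSup_nonneg hx) ?_)
  · rw [List.mem_ofFn]
    exact ⟨σ.symm i, by simp⟩
  · intro y hy
    obtain ⟨t, rfl⟩ := (List.mem_ofFn).1 hy
    exact le_ciSup (Set.finite_range x).bddAbove (σ t)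

theorem maxParam_eq (hn : 1 ≤ n) (X : Fin n → ThreePoint) (σ : Equiv.Perm (Fin n)) :
    maxParam X = listExpect ((List.ofFn σ).map X) listMax / 2 := by
  rw [maxParam, ← expect_perm]
  congr 1
  unfold expect
  refine Finset.sum_congr rfl fun ω _ => ?_
  beta_reduce
  rw [listMax_ofFn_perm hn _ (fun i => (X i).val_nonneg _) σ]

/-- A prophet inequality: the threshold `V(l)` gains at least half of the expected maximum. -/
theorem listExpect_max_le (X : Fin n → ThreePoint) (l : List (Fin n)) {c : ℝ}
    (hc : seqValue X l ≤ c) :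
    listExpect (l.map X) (fun xs => max c (listMax xs)) ≤ c + seqValue X l := by
  induction l generalizing c with
  | nil =>
    have : 0 ≤ c := hc
    simp [listExpect, seqValue, this]
  | cons i l ih =>
    have hl : seqValue X l ≤ c := ((X i).le_expMax _).trans hc
    calc listExpect ((i :: l).map X) (fun xs => max c (listMax xs))
        = ∑ j, (X i).prob j * listExpect (l.map X)
            (fun xs => max (max c ((X i).val j)) (listMax xs)) := by
          simp only [List.map_cons, listExpect, listMax_cons, max_assoc]
      _ ≤ ∑ j, (X i).prob j * (c + max ((X i).val j) (seqValue X l)) := by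
          refine (X i).sum_prob_mul_le fun j => ?_
          refine (ih (hl.trans (le_max_left _ _))).trans ?_
          -- Let `x` be the realized value. If `x ≥ c`, then `x + V(l) ≤ c + x` because `V(l) ≤ c`;
          -- otherwise the bound `c + V(l)` is already small enough.
          rcases le_total c ((X i).val j) with h | h
          · rw [max_eq_right h, max_eq_left (hl.trans h)]
            linarith
          · rw [max_eq_left h]
            linarith [le_max_right ((X i).val j) (seqValue X l)]
      _ = c + seqValue X (i :: l) := by
          simp only [mul_add, Finset.sum_add_distrib, (X i).sum_prob_mul_const]
          rfl

theorem listExpect_listMax_le (X : Fin n → ThreePoint) (l : List (Fin n)) :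
    listExpect (l.map X) listMax ≤ 2 * seqValue X l := by
  have h1 := listExpect_max_le X l le_rfl
  have h2 : listExpect (l.map X) listMax ≤ _ :=
    listExpect_mono _ fun xs => le_max_right (seqValue X l) (listMax xs)
  linarith

/-- A prophet who sees a supersequence does at least as well as any player. Sublists are allowed
because the second parts `T` contain only some of the processed variables. -/
theorem seqValue_le_listExpect (X : Fin n → ThreePoint) {t l : List (Fin n)}
    (h : t.Sublist l) : seqValue X t ≤ listExpect (l.map X) listMax := by
  induction h with
  | slnil => exact le_rfl
  | @cons t l i _ ih =>
    refine ih.trans ?_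
    rw [List.map_cons, listExpect, ← (X i).sum_prob_mul_const (listExpect (l.map X) listMax)]
    exact (X i).sum_prob_mul_le fun j => listExpect_mono _ fun xs => le_max_right _ _
  | @cons_cons t l i _ ih =>
    rw [List.map_cons, listExpect, seqValue, ThreePoint.expMax]
    refine (X i).sum_prob_mul_le fun j => ?_
    refine max_le ?_ (ih.trans (listExpect_mono _ fun xs => le_max_right _ _))
    exact (listExpect_const (l.map X) _).ge.trans (listExpect_mono _ fun xs => le_max_left _ _)

theorem maxParam_nonneg (hn : 1 ≤ n) (X : Fin n → ThreePoint) : 0 ≤ maxParam X := by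
  rw [maxParam_eq hn X 1]
  refine div_nonneg ?_ zero_le_two
  exact seqValue_le_listExpect X (List.nil_sublist _)

/-- The factor `1/2` in `MAX` is the one lost in the prophet inequality. An additive error measured
in `MAX` thereby becomes a relative error. -/
theorem maxParam_le_orderValue (hn : 1 ≤ n) (X : Fin n → ThreePoint) (σ : Equiv.Perm (Fin n)) :
    maxParam X ≤ orderValue X σ := by
  rw [maxParam_eq hn X σ, orderValue_eq]
  linarith [listExpect_listMax_le X (List.ofFn σ)]

/-! ## Sorting affine stages by an exchange argument -/

/-- The reward of passing a list of stages, where the stage `i` is accepted with probability `r i`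
and contributes `e i` to the expected reward. -/
def stageValue {α : Type*} (e r : α → ℝ) : List α → ℝ
  | [] => 0
  | i :: l => e i + (1 - r i) * stageValue e r l

/-- For two adjacent stages, `e j + (1 - r j) e i ≤ e i + (1 - r i) e j` is exactly `e j * r i ≤ e i
* r j`, and the coefficient of what follows is the same in both orders. The stage `i` moves forward
by such swaps. -/
theorem stageValue_move_front {α : Type*} {e r : α → ℝ} (hr : ∀ i, r i ≤ 1) (i : α)
    (l₁ l₂ : List α) (h : ∀ j ∈ l₁, e j * r i ≤ e i * r j) :
    stageValue e r (l₁ ++ i :: l₂) ≤ stageValue e r (i :: (l₁ ++ l₂)) := by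
  induction l₁ with
  | nil => exact le_rfl
  | cons j l₁ ih =>
    have h1 := ih fun k hk => h k (by simp [hk])
    have h2 := h j (by simp)
    have h3 := mul_le_mul_of_nonneg_left h1 (sub_nonneg.2 (hr j))
    simp only [stageValue, List.cons_append] at h3 ⊢
    linarith

/-- Selection sort: the stage that must come first is moved to the front, and the rest is sorted by
induction. The comparison of the ratios `e / r` is cross-multiplied to allow `r = 0`. In this form
it need not be transitive, hence the assumption on all pairs. -/
theorem stageValue_le_of_perm {α : Type*} {e r : α → ℝ} (hr : ∀ i, r i ≤ 1) {l l' : List α}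
    (hp : l.Perm l') (hs : l'.Pairwise fun i j => e j * r i ≤ e i * r j) :
    stageValue e r l ≤ stageValue e r l' := by
  induction l' generalizing l with
  | nil => rw [hp.eq_nil]
  | cons i l' ih =>
    obtain ⟨l₁, l₂, rfl⟩ := List.append_of_mem (hp.symm.subset List.mem_cons_self)
    have hp' : (l₁ ++ l₂).Perm l' := (List.perm_middle.symm.trans hp).cons_inv
    rw [List.pairwise_cons] at hs
    refine (stageValue_move_front hr i l₁ l₂ fun j hj =>
      hs.1 j (hp'.subset (List.mem_append_left _ hj))).trans ?_
    have := mul_le_mul_of_nonneg_left (ih hp' hs.2) (sub_nonneg.2 (hr i))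
    simp only [stageValue]
    linarith

/-! ## The structure of optimal orderings -/

open Classical in
/-- The probability of a positive value. -/
noncomputable def ThreePoint.posProb (Y : ThreePoint) : ℝ := if 0 < Y.m then Y.p + Y.q else Y.q

theorem ThreePoint.posProb_nonneg (Y : ThreePoint) : 0 ≤ Y.posProb := by
  have := Y.p_nonneg
  have := Y.q_nonneg
  unfold ThreePoint.posProb
  split_ifs <;> linarith

theorem ThreePoint.posProb_le_one (Y : ThreePoint) : Y.posProb ≤ 1 := by
  have := Y.p_add_q_le_one
  unfold ThreePoint.posProb
  split_ifs
  · exact this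
  · exact Y.q_le_one

theorem ThreePoint.condMean_eq (Y : ThreePoint) :
    Y.condMean = (Y.p * Y.m + Y.q) / Y.posProb := by
  unfold ThreePoint.condMean ThreePoint.posProb
  rw [Fin.sum_univ_three, Fin.sum_univ_three]
  by_cases h : 0 < Y.m
  · simp [ThreePoint.val, ThreePoint.prob, h]
  · have : Y.m = 0 := le_antisymm (not_lt.1 h) Y.m_nonneg
    simp [ThreePoint.val, ThreePoint.prob, this]

theorem ThreePoint.mean_le_posProb (Y : ThreePoint) : Y.p * Y.m + Y.q ≤ Y.posProb := by
  unfold ThreePoint.posProb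
  split_ifs with h
  · nlinarith [Y.p_nonneg, Y.m_le_one]
  · rw [le_antisymm (not_lt.1 h) Y.m_nonneg]
    simp

theorem ThreePoint.mean_nonneg (Y : ThreePoint) : 0 ≤ Y.p * Y.m + Y.q := by
  have := mul_nonneg Y.p_nonneg Y.m_nonneg
  linarith [Y.q_nonneg]

/-- This survives the convention `0 / 0 = 0`: if the probability of a positive value vanishes, so
does the mean. -/
theorem ThreePoint.condMean_mul_posProb (Y : ThreePoint) :
    Y.condMean * Y.posProb = Y.p * Y.m + Y.q := by
  rw [Y.condMean_eq]
  rcases eq_or_ne Y.posProb 0 with h | h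
  · rw [h, mul_zero]
    linarith [Y.mean_nonneg, Y.mean_le_posProb]
  · exact div_mul_cancel₀ _ h

/-- Accepting every positive value is no better than the optimal rule. -/
theorem ThreePoint.stage_le_expMax (Y : ThreePoint) {v : ℝ} (hv : 0 ≤ v) :
    Y.p * Y.m + Y.q + (1 - Y.posProb) * v ≤ Y.expMax v := by
  rw [Y.expMax_eq, max_eq_right hv]
  have h1 := mul_le_mul_of_nonneg_left (le_max_left Y.m v) Y.p_nonneg
  have h2 := mul_le_mul_of_nonneg_left (le_max_left 1 v) Y.q_nonneg
  unfold ThreePoint.posProb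
  split_ifs with h
  · linarith
  · have h3 := mul_le_mul_of_nonneg_left (le_max_right Y.m v) Y.p_nonneg
    rw [le_antisymm (not_lt.1 h) Y.m_nonneg] at h3 ⊢
    linarith

/-- Accepting only the right endpoint is no better than the optimal rule. -/
theorem ThreePoint.first_le_expMax (Y : ThreePoint) {v : ℝ} (hv : 0 ≤ v) :
    Y.q + (1 - Y.q) * v ≤ Y.expMax v := by
  rw [Y.expMax_eq, max_eq_right hv]
  have h1 := mul_le_mul_of_nonneg_left (le_max_right Y.m v) Y.p_nonneg
  have h2 := mul_le_mul_of_nonneg_left (le_max_left 1 v) Y.q_nonneg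
  linarith

/-- One of these two rules is optimal. -/
theorem ThreePoint.expMax_eq_stage (Y : ThreePoint) {v : ℝ} (hv : 0 ≤ v) (hv1 : v ≤ 1) :
    Y.expMax v = Y.q + (1 - Y.q) * v ∨
      Y.expMax v = Y.p * Y.m + Y.q + (1 - Y.posProb) * v := by
  rw [Y.expMax_eq, max_eq_right hv, max_eq_left hv1]
  rcases le_total Y.m v with h | h
  · left
    rw [max_eq_right h]
    ring
  · right
    rw [max_eq_left h]
    unfold ThreePoint.posProb
    split_ifs with h'
    · ring
    · have h0 : Y.m = 0 := le_antisymm (not_lt.1 h') Y.m_nonneg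
      have h1 : v = 0 := le_antisymm (h0 ▸ h) hv
      rw [h0, h1]
      ring

/-- The expected contribution of a variable, accepted only at `1` if `b i` holds, and at every
positive value otherwise. -/
def modeGain (X : Fin n → ThreePoint) (b : Fin n → Bool) (i : Fin n) : ℝ :=
  if b i then (X i).q else (X i).p * (X i).m + (X i).q

/-- The acceptance probability of a variable, accepted only at `1` if `b i` holds, and at every
positive value otherwise. -/
noncomputable def modeProb (X : Fin n → ThreePoint) (b : Fin n → Bool) (i : Fin n) : ℝ :=
  if b i then (X i).q else (X i).posProb

theorem modeProb_le_one (X : Fin n → ThreePoint) (b : Fin n → Bool) (i : Fin n) :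
    modeProb X b i ≤ 1 := by
  unfold modeProb
  split_ifs
  · exact (X i).q_le_one
  · exact (X i).posProb_le_one

theorem stageValue_congr {α : Type*} {e r e' r' : α → ℝ} {l : List α}
    (he : ∀ i ∈ l, e i = e' i) (hr : ∀ i ∈ l, r i = r' i) :
    stageValue e r l = stageValue e' r' l := by
  induction l with
  | nil => rfl
  | cons i l ih =>
    simp only [stageValue]
    rw [he i (by simp), hr i (by simp), ih (fun j hj => he j (by simp [hj]))
      fun j hj => hr j (by simp [hj])]

/-- The mode of each variable is read off from the continuation value behind it. Distinctness of the
variables makes the mode a function of the variable: setting it at the head does not disturb the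
tail. -/
theorem exists_mode (X : Fin n → ThreePoint) {l : List (Fin n)} (hl : l.Nodup) :
    ∃ b : Fin n → Bool, seqValue X l = stageValue (modeGain X b) (modeProb X b) l := by
  induction l with
  | nil => exact ⟨fun _ => true, rfl⟩
  | cons i l ih =>
    rw [List.nodup_cons] at hl
    obtain ⟨b, hb⟩ := ih hl.2
    have key : ∀ c : Bool, stageValue (modeGain X b) (modeProb X b) l =
        stageValue (modeGain X (Function.update b i c)) (modeProb X (Function.update b i c)) l := by
      intro c
      have hne : ∀ j ∈ l, Function.update b i c j = b j := fun j hj =>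
        Function.update_of_ne (ne_of_mem_of_not_mem hj hl.1) _ _
      exact stageValue_congr (fun j hj => by simp only [modeGain, hne j hj])
        fun j hj => by simp only [modeProb, hne j hj]
    rcases (X i).expMax_eq_stage (seqValue_nonneg X l) (seqValue_le_one X l) with h | h
    · refine ⟨Function.update b i true, ?_⟩
      rw [seqValue, h, hb, stageValue, ← key]
      simp [modeGain, modeProb]
    · refine ⟨Function.update b i false, ?_⟩
      rw [seqValue, h, hb, stageValue, ← key]
      simp [modeGain, modeProb]

/-- On `s` the affine stages reproduce `firstValue` exactly. The inequality comes from `t`, where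
accepting every positive value is only one of the possible rules. -/
theorem stageValue_mode_append_le (X : Fin n → ThreePoint) (b : Fin n → Bool)
    (s t : List (Fin n)) (hs : ∀ i ∈ s, b i = true) (ht : ∀ i ∈ t, b i = false) :
    stageValue (modeGain X b) (modeProb X b) (s ++ t) ≤
      firstValue X s + (1 - firstValue X s) * seqValue X t := by
  induction s with
  | nil =>
    simp only [List.nil_append, firstValue, sub_zero, one_mul, zero_add]
    induction t with
    | nil => exact le_rfl
    | cons i t ih =>
      have h1 := ih fun j hj => ht j (by simp [hj])
      have h2 := (X i).stage_le_expMax (seqValue_nonneg X t)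
      have h3 := mul_le_mul_of_nonneg_left h1 (sub_nonneg.2 (X i).posProb_le_one)
      simp only [stageValue, modeGain, modeProb, ht i (by simp), seqValue] at h3 ⊢
      simp only [Bool.false_eq_true, if_false]
      linarith
  | cons i s ih =>
    have h1 := ih fun j hj => hs j (by simp [hj])
    have h3 := mul_le_mul_of_nonneg_left h1 (sub_nonneg.2 (X i).q_le_one)
    rw [List.cons_append, firstValue_cons]
    simp only [stageValue, modeGain, modeProb, hs i (by simp)] at h3 ⊢
    simp only [if_true]
    linarith

/-- A lower bound for the value of the concatenation. -/
theorem le_seqValue_append (X : Fin n → ThreePoint) (s t : List (Fin n)) :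
    firstValue X s + (1 - firstValue X s) * seqValue X t ≤ seqValue X (s ++ t) := by
  induction s with
  | nil => simp [firstValue]
  | cons i s ih =>
    rw [firstValue_cons, List.cons_append, seqValue]
    have h2 := (X i).first_le_expMax (seqValue_nonneg X (s ++ t))
    have h3 := mul_le_mul_of_nonneg_left ih (sub_nonneg.2 (X i).q_le_one)
    linarith

/-- Every ordering is dominated by an ordered partition `(S, T)` in which the order of the variables
of `T` is a given order with decreasing `E[X_i | X_i > 0]`. -/
theorem exists_partition (X : Fin n → ThreePoint) {l o : List (Fin n)} (hl : l.Nodup)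
    (hp : l.Perm o) (ho : o.Pairwise fun i j => (X j).condMean ≤ (X i).condMean) :
    ∃ b : Fin n → Bool, seqValue X l ≤ firstValue X (o.filter fun i => b i) +
      (1 - firstValue X (o.filter fun i => b i)) * seqValue X (o.filter fun i => !b i) := by
  obtain ⟨b, hb⟩ := exists_mode X hl
  refine ⟨b, hb.le.trans (le_trans ?_ (stageValue_mode_append_le X b _ _ ?_ ?_))⟩
  · refine stageValue_le_of_perm (modeProb_le_one X b)
      (hp.trans (List.filter_append_perm (fun i => b i) o).symm) ?_
    -- The ratio `e / r` is `1` throughout the first part and `E_i` in the second. Three comparisons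
    -- remain: equality within the first part, the given order within the second, and `E_j ≤ 1`
    -- across the two.
    rw [List.pairwise_append]
    refine ⟨?_, ?_, ?_⟩
    · refine List.Pairwise.imp_of_mem ?_ (List.pairwise_of_forall (R := fun _ _ => True) (by simp))
      intro i j hi hj _
      have hi := (List.mem_filter.1 hi).2
      have hj := (List.mem_filter.1 hj).2
      simp only [modeGain, modeProb, hi, hj, if_true]
      linarith
    · refine List.Pairwise.imp_of_mem ?_ (ho.filter _)
      intro i j hi hj h
      have hi := (List.mem_filter.1 hi).2
      have hj := (List.mem_filter.1 hj).2
      simp only [Bool.not_eq_true'] at hi hj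
      simp only [modeGain, modeProb, hi, hj, Bool.false_eq_true, if_false]
      rw [← (X i).condMean_mul_posProb, ← (X j).condMean_mul_posProb]
      have := mul_le_mul_of_nonneg_right h
        (mul_nonneg (X i).posProb_nonneg (X j).posProb_nonneg)
      linarith
    · intro i hi j hj
      have hi := (List.mem_filter.1 hi).2
      have hj := (List.mem_filter.1 hj).2
      simp only [Bool.not_eq_true'] at hj
      simp only [modeGain, modeProb, hi, hj, Bool.false_eq_true, if_false, if_true]
      have := mul_le_mul_of_nonneg_right (X j).mean_le_posProb (X i).q_nonneg
      linarith
  · exact fun i hi => (List.mem_filter.1 hi).2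
  · exact fun i hi => by simpa using (List.mem_filter.1 hi).2

/-! ## Trimming -/

theorem gridRatio_bounds {ε : ℝ} (hn : 1 ≤ n) (h0 : 0 < ε) (h1 : ε < 1) :
    0 < gridRatio n ε ∧ gridRatio n ε < 1 := by
  have hn' : (1 : ℝ) ≤ n := by exact_mod_cast hn
  unfold gridRatio
  constructor
  · rw [sub_pos, div_lt_one (by linarith)]
    linarith
  · have : 0 < ε / (2 * n) := by positivity
    linarith

theorem threshold_nonneg {ε : ℝ} (hn : 1 ≤ n) (X : Fin n → ThreePoint) (h0 : 0 < ε) :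
    0 ≤ threshold X ε :=
  mul_nonneg (by positivity) (maxParam_nonneg hn X)

theorem seqValue_le_maxValue (X : Fin n → ThreePoint) {L : Set (SeqPair n)} {P : SeqPair n}
    (hP : P ∈ L) : seqValue X P.2 ≤ maxValue X L := by
  refine le_csSup ⟨1, ?_⟩ ⟨P, hP, rfl⟩
  rintro _ ⟨Q, _, rfl⟩
  exact seqValue_le_one X _

/-- A pair whose value `V(T)` is not too small lies in a bucket. -/
theorem exists_bucket (X : Fin n → ThreePoint) {ε : ℝ} (hn : 1 ≤ n) (h0 : 0 < ε) (h1 : ε < 1)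
    {L : Set (SeqPair n)} {P : SeqPair n} (hP : P ∈ L) (hv : 0 < seqValue X P.2)
    (hθ : threshold X ε ≤ gridRatio n ε * seqValue X P.2) :
    ∃ j, P ∈ bucket X ε L (j + 1) := by
  obtain ⟨hr0, hr1⟩ := gridRatio_bounds hn h0 h1
  have hle := seqValue_le_maxValue X hP
  have hmx : 0 < maxValue X L := hv.trans_le hle
  obtain ⟨j, hj1, hj2⟩ := exists_nat_pow_near_of_lt_one (div_pos hv hmx)
    ((div_le_one hmx).2 hle) hr0 hr1
  rw [lt_div_iff₀ hmx] at hj1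
  rw [div_le_iff₀ hmx] at hj2
  refine ⟨j, hP, ?_, hj1, hj2⟩
  -- The bucket exists only if its lower end is at least the threshold. Its lower end is `ρ` times
  -- its upper end, hence at least `ρ V(T)`; this is why the hypothesis carries a factor `ρ`.
  calc threshold X ε ≤ gridRatio n ε * seqValue X P.2 := hθ
    _ ≤ gridRatio n ε * (gridRatio n ε ^ j * maxValue X L) := by gcongr
    _ = _ := by ring

theorem IsTrim.subset {X : Fin n → ThreePoint} {ε : ℝ} {L L' : Set (SeqPair n)}
    (h : IsTrim X ε L L') : L' ⊆ L := by
  obtain ⟨c, hc, rfl⟩ := h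
  rintro _ ⟨j, hj, rfl⟩
  have := (hc j hj).1
  cases j with
  | zero => exact this.1
  | succ j => exact this.1

/-- Trimming keeps a pair that is almost as good as a given pair. -/
theorem IsTrim.exists_approx {X : Fin n → ThreePoint} {ε : ℝ} (hn : 1 ≤ n) (h0 : 0 < ε)
    (h1 : ε < 1) {L L' : Set (SeqPair n)} (h : IsTrim X ε L L') {P Z : SeqPair n} (hP : P ∈ L)
    (hZ : Z ∈ L) (hZ2 : Z.2 = []) (hZ1 : ∀ Q ∈ L, firstValue X Q.1 ≤ firstValue X Z.1) :
    ∃ Q ∈ L', firstValue X P.1 ≤ firstValue X Q.1 ∧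
      (gridRatio n ε * seqValue X P.2 ≤ seqValue X Q.2 ∨
        gridRatio n ε * seqValue X P.2 ≤ threshold X ε) := by
  obtain ⟨hr0, hr1⟩ := gridRatio_bounds hn h0 h1
  obtain ⟨c, hc, rfl⟩ := h
  by_cases hb : 0 < seqValue X P.2 ∧ threshold X ε ≤ gridRatio n ε * seqValue X P.2
  · obtain ⟨j, hj⟩ := exists_bucket X hn h0 h1 hP hb.1 hb.2
    obtain ⟨hc1, hc2⟩ := hc (j + 1) ⟨P, hj⟩
    refine ⟨c (j + 1), ⟨j + 1, ⟨P, hj⟩, rfl⟩, hc2 P hj, Or.inl ?_⟩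
    refine le_trans ?_ hc1.2.2.1.le
    rw [pow_succ', mul_assoc]
    exact mul_le_mul_of_nonneg_left hj.2.2.2 hr0.le
  -- Here `V(T)` is zero or too small for the grid. The representative of `B_0` has the largest
  -- first value of all pairs, and giving up `V(T)` costs at most the threshold after scaling by
  -- `ρ`.
  · have hZ0 : Z ∈ bucket X ε L 0 := ⟨hZ, hZ2⟩
    obtain ⟨_, hc2⟩ := hc 0 ⟨Z, hZ0⟩
    refine ⟨c 0, ⟨0, ⟨Z, hZ0⟩, rfl⟩, (hZ1 P hP).trans (hc2 Z hZ0), ?_⟩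
    by_cases hv : 0 < seqValue X P.2
    · right
      exact le_of_not_ge fun h' => hb ⟨hv, h'⟩
    · left
      rw [le_antisymm (not_lt.1 hv) (seqValue_nonneg X _), mul_zero]
      exact seqValue_nonneg X _

/-! ## Runs of the algorithm -/

/-- The first `k` variables in the order `π`, the latest one first. -/
def processed (π : Equiv.Perm (Fin n)) (k : ℕ) : List (Fin n) := ((List.ofFn π).take k).reverse

theorem processed_zero (π : Equiv.Perm (Fin n)) : processed π 0 = [] := rfl

theorem processed_succ (π : Equiv.Perm (Fin n)) (k : Fin n) :
    processed π (k + 1) = π k :: processed π k := by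
  unfold processed
  rw [List.take_add_one, List.reverse_append]
  simp

/-- Putting every variable into `S` maximizes `R(S)` and leaves `T` empty, so `B_0` is never empty
and its representative is always maximal. This pair is the fallback for values that are too small
for the grid. -/
theorem IsRun.exists_nil_snd {X : Fin n → ThreePoint} {ε : ℝ} {π : Equiv.Perm (Fin n)}
    {L : ℕ → Set (SeqPair n)} (h : IsRun X ε π L) (k : ℕ) (hk : k ≤ n) :
    ∃ Z ∈ L k, Z.2 = [] ∧ ∀ Q ∈ L k, firstValue X Q.1 ≤ firstValue X Z.1 := by
  induction k with
  | zero =>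
    rw [h.init]
    exact ⟨_, rfl, rfl, by rintro _ rfl; exact le_rfl⟩
  | succ k ih =>
    obtain ⟨Z, hZ, hZ2, hZ1⟩ := ih (by omega)
    have ht : IsTrim X ε (expand (π ⟨k, hk⟩) (L k)) (L (k + 1)) := h.trim ⟨k, hk⟩
    have hsub := ht.subset
    obtain ⟨c, hc, hL⟩ := ht
    have hZ0 : (π ⟨k, hk⟩ :: Z.1, Z.2) ∈ bucket X ε (expand (π ⟨k, hk⟩) (L k)) 0 :=
      ⟨⟨Z, hZ, Or.inl rfl⟩, hZ2⟩
    obtain ⟨hc1, hc2⟩ := hc 0 ⟨_, hZ0⟩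
    refine ⟨c 0, hL ▸ ⟨0, ⟨_, hZ0⟩, rfl⟩, hc1.2, fun Q hQ => le_trans ?_ (hc2 _ hZ0)⟩
    obtain ⟨Q', hQ', rfl | rfl⟩ := hsub hQ
    · exact firstValue_cons_le X _ (hZ1 _ hQ')
    · exact (hZ1 _ hQ').trans (firstValue_le_cons X _ _)

/-- Every ordered partition in the order of a run is approximated by a pair of the run. -/
theorem IsRun.exists_approx {X : Fin n → ThreePoint} {ε : ℝ} (hn : 1 ≤ n) (h0 : 0 < ε)
    (h1 : ε < 1) {π : Equiv.Perm (Fin n)} {L : ℕ → Set (SeqPair n)} (h : IsRun X ε π L)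
    (b : Fin n → Bool) (k : ℕ) (hk : k ≤ n) :
    ∃ P ∈ L k, firstValue X ((processed π k).filter fun i => b i) ≤ firstValue X P.1 ∧
      gridRatio n ε ^ k * seqValue X ((processed π k).filter fun i => !b i) - k * threshold X ε ≤
        seqValue X P.2 := by
  obtain ⟨hr0, hr1⟩ := gridRatio_bounds hn h0 h1
  have hθ := threshold_nonneg hn X h0
  induction k with
  | zero =>
    rw [h.init]
    exact ⟨_, rfl, le_rfl, by simp [processed_zero]⟩
  | succ k ih =>
    obtain ⟨P, hP, hP1, hP2⟩ := ih (by omega)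
    obtain ⟨Z, hZ, hZ2, hZ1⟩ := h.exists_nil_snd k (by omega)
    have ht : IsTrim X ε (expand (π ⟨k, hk⟩) (L k)) (L (k + 1)) := h.trim ⟨k, hk⟩
    have hproc : processed π (k + 1) = π ⟨k, hk⟩ :: processed π k := processed_succ π ⟨k, hk⟩
    set i := π ⟨k, hk⟩
    -- Extending the fallback pair by putting `i` into its first part keeps it maximal among all
    -- expanded pairs.
    have hZ1' : ∀ Q ∈ expand i (L k), firstValue X Q.1 ≤ firstValue X (i :: Z.1) := by
      rintro _ ⟨Q, hQ, rfl | rfl⟩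
      · exact firstValue_cons_le X _ (hZ1 _ hQ)
      · exact (hZ1 _ hQ).trans (firstValue_le_cons X _ _)
    obtain ⟨P', hP', hP1', hP2'⟩ : ∃ P' ∈ expand i (L k),
        firstValue X ((processed π (k + 1)).filter fun i => b i) ≤ firstValue X P'.1 ∧
        gridRatio n ε ^ k * seqValue X ((processed π (k + 1)).filter fun i => !b i) -
          k * threshold X ε ≤ seqValue X P'.2 := by
      rw [hproc]
      cases hb : b i
      · refine ⟨(P.1, i :: P.2), ⟨P, hP, Or.inr rfl⟩, ?_, ?_⟩
        · simpa [List.filter_cons, hb] using hP1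
        · simp only [List.filter_cons, hb, Bool.not_false, if_true, seqValue]
          exact (X i).mul_expMax_sub_le (pow_le_one₀ hr0.le hr1.le) (by positivity) hP2
      · refine ⟨(i :: P.1, P.2), ⟨P, hP, Or.inl rfl⟩, ?_, ?_⟩
        · simp only [List.filter_cons, hb, if_true]
          exact firstValue_cons_le X i hP1
        · simpa [List.filter_cons, hb] using hP2
    obtain ⟨Q, hQ, hQ1, hQ2⟩ := ht.exists_approx hn h0 h1 hP'
      (Z := (i :: Z.1, Z.2)) ⟨Z, hZ, Or.inl rfl⟩ hZ2 hZ1'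
    refine ⟨Q, hQ, hP1'.trans hQ1, ?_⟩
    have h2 := mul_le_mul_of_nonneg_left hP2' hr0.le
    have h3 : gridRatio n ε * (k * threshold X ε) ≤ 1 * (k * threshold X ε) :=
      mul_le_mul_of_nonneg_right hr1.le (by positivity)
    rw [pow_succ']
    -- With `e = k θ`, trimming turns a guarantee `ρ ^ k V - e` into `ρ ^ (k + 1) V - ρ e` or into
    -- `ρ ^ (k + 1) V - ρ e ≤ θ`. In both cases `ρ e ≤ e` leaves an additive loss of at most `(k +
    -- 1) θ`.
    push_cast
    have h4 := seqValue_nonneg X Q.2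
    rcases hQ2 with hQ2 | hQ2 <;> nlinarith

/-- The approximation guarantee. -/
theorem IsOutput.le_orderValue {X : Fin n → ThreePoint} {ε : ℝ} (hn : 1 ≤ n) (h0 : 0 < ε)
    (h1 : ε < 1) {σ : Equiv.Perm (Fin n)} (h : IsOutput X ε σ) :
    (1 - ε) * optValue X ≤ orderValue X σ := by
  obtain ⟨hr0, hr1⟩ := gridRatio_bounds hn h0 h1
  obtain ⟨π, L, hrun, P, hP, hσ, hmax⟩ := h
  obtain ⟨τ, hτ⟩ := exists_eq_ciSup_of_finite (f := fun σ => orderValue X σ)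
  rw [optValue, ← hτ]
  have hproc : processed π n = (List.ofFn π).reverse := by
    unfold processed
    rw [List.take_of_length_le (by simp)]
  have hperm : (List.ofFn τ).Perm (processed π n) := by
    rw [hproc]
    refine List.Perm.trans ?_ (List.reverse_perm _).symm
    refine (List.perm_ext_iff_of_nodup (List.nodup_ofFn.2 τ.injective)
      (List.nodup_ofFn.2 π.injective)).2 fun i => ?_
    simp only [List.mem_ofFn]
    exact iff_of_true (τ.surjective i) (π.surjective i)
  have hpair : (processed π n).Pairwise fun i j => (X j).condMean ≤ (X i).condMean := by
    rw [hproc, List.pairwise_reverse, List.pairwise_ofFn]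
    exact fun i j hij => hrun.sorted hij.le
  obtain ⟨b, hb⟩ := exists_partition X (List.nodup_ofFn.2 τ.injective) hperm hpair
  obtain ⟨Q, hQ, hQ1, hQ2⟩ := hrun.exists_approx hn h0 h1 b n le_rfl
  have hmp := maxParam_le_orderValue hn X τ
  rw [orderValue_eq] at hmp ⊢
  rw [orderValue_eq, hσ]
  refine le_trans ?_ (hmax Q hQ)
  refine le_trans ?_ (le_seqValue_append X Q.1 Q.2)
  have hn' : (1 : ℝ) ≤ n := by exact_mod_cast hn
  have hθ : n * threshold X ε = ε / 2 * maxParam X := by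
    unfold threshold
    field_simp
  -- Bernoulli's inequality with `n * (ε / (2 * n)) = ε / 2`.
  have hbern : 1 - ε / 2 ≤ gridRatio n ε ^ n := by
    have := one_add_mul_le_pow (a := -(ε / (2 * n))) (by
      have : ε / (2 * n) ≤ 1 := (div_le_one (by linarith)).2 (by linarith)
      linarith) n
    have h2 : (n : ℝ) * (ε / (2 * n)) = ε / 2 := by field_simp
    unfold gridRatio
    rw [sub_eq_add_neg 1 (ε / (2 * n))]
    linarith
  rw [hθ] at hQ2
  set S := firstValue X ((processed π n).filter fun i => b i)
  set T := seqValue X ((processed π n).filter fun i => !b i)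
  have hS : 0 ≤ S ∧ S ≤ 1 := firstValue_mem X _
  have hT : 0 ≤ T := seqValue_nonneg X _
  have hM := maxParam_nonneg hn X
  have hv := seqValue_le_one X Q.2
  set V := seqValue X (List.ofFn τ)
  set M := maxParam X
  have e1 : (1 - ε / 2) * T - ε / 2 * M ≤ seqValue X Q.2 := by nlinarith
  -- The expression `R + (1 - R) v` increases in `R` because `v ≤ 1`.
  have e2 : S + (1 - S) * seqValue X Q.2 ≤
      firstValue X Q.1 + (1 - firstValue X Q.1) * seqValue X Q.2 := by nlinarith
  have e3 : (1 - S) * ((1 - ε / 2) * T - ε / 2 * M) ≤ (1 - S) * seqValue X Q.2 :=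
    mul_le_mul_of_nonneg_left e1 (by linarith)
  have e4 : (1 - ε / 2) * V ≤ (1 - ε / 2) * (S + (1 - S) * T) :=
    mul_le_mul_of_nonneg_left hb (by linarith)
  have e5 : ε / 2 * M ≤ ε / 2 * V := mul_le_mul_of_nonneg_left hmp (by linarith)
  have e6 : 0 ≤ S * (ε / 2 * M) := by have := hS.1; positivity
  have e7 : 0 ≤ ε / 2 * S := by have := hS.1; positivity
  linarith

/-! ## Results and times of compound programs -/

@[simp] theorem Timed.ret_bind {α β : Type} (x : Timed α) (f : α → Timed β) :
    (x >>= f).ret = (f x.ret).ret := rfl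

@[simp] theorem Timed.time_bind {α β : Type} (x : Timed α) (f : α → Timed β) :
    (x >>= f).time = x.time + (f x.ret).time := rfl

@[simp] theorem Timed.ret_pure {α : Type} (a : α) : (pure a : Timed α).ret = a := rfl

@[simp] theorem Timed.time_pure {α : Type} (a : α) : (pure a : Timed α).time = 0 := rfl

@[simp] theorem time_tick : tick.time = 1 := rfl

@[simp] theorem ret_radd (x y : ℝ) : (radd x y).ret = x + y := rfl
@[simp] theorem ret_rsub (x y : ℝ) : (rsub x y).ret = x - y := rfl
@[simp] theorem ret_rmul (x y : ℝ) : (rmul x y).ret = x * y := rfl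
@[simp] theorem ret_rdiv (x y : ℝ) : (rdiv x y).ret = x / y := rfl
@[simp] theorem ret_rmax (x y : ℝ) : (rmax x y).ret = max x y := rfl
@[simp] theorem ret_rle (x y : ℝ) : (rle x y).ret = true ↔ x ≤ y := by simp [rle]
@[simp] theorem time_radd (x y : ℝ) : (radd x y).time = 1 := rfl
@[simp] theorem time_rsub (x y : ℝ) : (rsub x y).time = 1 := rfl
@[simp] theorem time_rmul (x y : ℝ) : (rmul x y).time = 1 := rfl
@[simp] theorem time_rdiv (x y : ℝ) : (rdiv x y).time = 1 := rfl
@[simp] theorem time_rmax (x y : ℝ) : (rmax x y).time = 1 := rfl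
@[simp] theorem time_rle (x y : ℝ) : (rle x y).time = 1 := rfl

/-! ## List programs and sorting -/

theorem mapT_ret {α β : Type} (f : α → Timed β) (l : List α) :
    (mapT f l).ret = l.map fun a => (f a).ret := by
  induction l with
  | nil => rfl
  | cons a l ih => simp [mapT, ih]

theorem appendT_ret {α : Type} (l l' : List α) : (appendT l l').ret = l ++ l' := by
  induction l with
  | nil => rfl
  | cons a l ih => simp [appendT, ih]

theorem insertT_perm {α : Type} (a : ℝ × α) (l : List (ℝ × α)) :
    (insertT a l).ret.Perm (a :: l) := by
  induction l with
  | nil => exact List.Perm.refl _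
  | cons b l ih =>
    simp only [insertT, Timed.ret_bind, ret_rle]
    split_ifs
    · exact List.Perm.refl _
    · exact (ih.cons b).trans (List.Perm.swap a b l)

theorem insertT_pairwise {α : Type} (a : ℝ × α) {l : List (ℝ × α)}
    (h : l.Pairwise fun x y => x.1 ≤ y.1) :
    (insertT a l).ret.Pairwise fun x y => x.1 ≤ y.1 := by
  induction l with
  | nil => simp [insertT]
  | cons b l ih =>
    have h' := List.pairwise_cons.1 h
    simp only [insertT, Timed.ret_bind, ret_rle]
    split_ifs with hab
    · refine List.pairwise_cons.2 ⟨fun c hc => ?_, h⟩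
      rcases List.mem_cons.1 hc with rfl | hc
      · exact hab
      · exact hab.trans (h'.1 c hc)
    · refine List.pairwise_cons.2 ⟨fun c hc => ?_, ih h'.2⟩
      rcases List.mem_cons.1 ((insertT_perm a l).subset hc) with rfl | hc
      · exact (not_le.1 hab).le
      · exact h'.1 c hc

theorem sortT_perm {α : Type} (l : List (ℝ × α)) : (sortT l).ret.Perm l := by
  induction l with
  | nil => exact List.Perm.refl _
  | cons a l ih => exact (insertT_perm a _).trans (ih.cons a)

theorem sortT_pairwise {α : Type} (l : List (ℝ × α)) :
    (sortT l).ret.Pairwise fun x y => x.1 ≤ y.1 := by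
  induction l with
  | nil => exact List.Pairwise.nil
  | cons a l ih => exact insertT_pairwise a ih

theorem sortByT_ret {α : Type} (key : α → Timed ℝ) (l : List α) :
    (sortByT key l).ret = (sortT (l.map fun a => ((key a).ret, a))).ret.map Prod.snd := by
  simp only [sortByT, Timed.ret_bind, mapT_ret, Timed.ret_pure]

theorem sortByT_perm {α : Type} (key : α → Timed ℝ) (l : List α) :
    (sortByT key l).ret.Perm l := by
  rw [sortByT_ret]
  have h := (sortT_perm (l.map fun a => ((key a).ret, a))).map Prod.snd
  rwa [List.map_map, show (Prod.snd ∘ fun a => ((key a).ret, a)) = id from rfl, List.map_id] at h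

theorem sortByT_pairwise {α : Type} (key : α → Timed ℝ) (l : List α) :
    (sortByT key l).ret.Pairwise fun a b => (key a).ret ≤ (key b).ret := by
  rw [sortByT_ret, List.pairwise_map]
  refine List.Pairwise.imp_of_mem ?_ (sortT_pairwise _)
  intro x y hx hy h
  have hx := (sortT_perm _).subset hx
  have hy := (sortT_perm _).subset hy
  obtain ⟨a, _, rfl⟩ := List.mem_map.1 hx
  obtain ⟨b, _, rfl⟩ := List.mem_map.1 hy
  exact h

theorem exists_perm_ofFn {l : List (Fin n)} (h : l.Perm (List.finRange n)) :
    ∃ σ : Equiv.Perm (Fin n), List.ofFn σ = l := by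
  have hlen : l.length = n := by rw [h.length_eq, List.length_finRange]
  have hnd : l.Nodup := h.nodup_iff.2 (List.nodup_finRange n)
  have hinj : Function.Injective fun i : Fin n => l.get (i.cast hlen.symm) := by
    intro i j hij
    simpa using List.nodup_iff_injective_get.1 hnd hij
  refine ⟨Equiv.ofBijective _ (Finite.injective_iff_bijective.1 hinj), ?_⟩
  refine List.ext_get (by simp [hlen]) fun i h1 h2 => ?_
  simp

/-! ## Values of single variables -/

theorem condMeanT_ret (Y : ThreePoint) : (condMeanT Y).ret = Y.condMean := by
  have hp := Y.posProb_nonneg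
  have hdiv : ∀ x d : ℝ, 0 ≤ d → (if d ≤ 0 then 0 else x / d) = x / d := by
    intro x d hd
    split_ifs with h
    · rw [le_antisymm h hd, div_zero]
    · rfl
  rw [Y.condMean_eq, ← hdiv _ _ hp]
  unfold condMeanT ThreePoint.posProb
  simp only [← not_le, Timed.ret_bind, ret_rle, ret_rmul, ret_radd]
  by_cases h : Y.m ≤ 0
  · simp only [h, if_true, not_true, if_false, Timed.ret_bind, Timed.ret_pure, ret_rle]
    split_ifs <;> rfl
  · simp only [h, if_true, not_false_eq_true, if_false, Timed.ret_bind, ret_radd, ret_rle]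
    split_ifs <;> rfl

theorem expMaxT_ret (Y : ThreePoint) (v : ℝ) : (expMaxT Y v).ret = Y.expMax v := by
  simp [expMaxT, Y.expMax_eq]

theorem valueFromT_ret (X : Fin n → ThreePoint) (s t : List (Fin n)) :
    (valueFromT X s (seqValue X t)).ret = seqValue X (s ++ t) := by
  induction s with
  | nil => rfl
  | cons i s ih => simp [valueFromT, ih, expMaxT_ret, seqValue]

/-! ## The expected maximum -/

theorem expectMaxT_cons_ret (X : Fin n → ThreePoint) (i : Fin n) (l : List (Fin n)) (P G : ℝ) :
    (expectMaxT X (i :: l) P G).ret = (expectMaxT X l ((1 - (X i).q) * P)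
      ((X i).p * (X i).m * P + (1 - (X i).p - (X i).q) * G)).ret := rfl

/-- Every step of the recursion is linear in the state `(P, G)` and the result is `1 - P + G`.
Subtracting `1` therefore makes the result linear, and states can be superposed. -/
theorem expectMaxT_linear (X : Fin n → ThreePoint) (l : List (Fin n)) (a b P G P' G' : ℝ) :
    (expectMaxT X l (a * P + b * P') (a * G + b * G')).ret - 1 =
      a * ((expectMaxT X l P G).ret - 1) + b * ((expectMaxT X l P' G').ret - 1) := by
  induction l generalizing P G P' G' with
  | nil =>
    simp only [expectMaxT, Timed.ret_bind, ret_radd, ret_rsub]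
    ring
  | cons i l ih =>
    simp only [expectMaxT_cons_ret]
    rw [← ih]
    congr 3 <;> ring

theorem listExpect_max_one (l : List ThreePoint) :
    listExpect l (fun xs => max 1 (listMax xs)) = 1 := by
  induction l with
  | nil => simp [listExpect]
  | cons Y l ih =>
    have h : ∀ j xs, max 1 (listMax (Y.val j :: xs)) = max 1 (listMax xs) := fun j xs => by
      rw [listMax_cons, ← max_assoc, max_eq_left (Y.val_le_one j)]
    simp only [listExpect, h, ih, Y.sum_prob_mul_const]

/-- The state `(1, c)` describes a current maximum `c` that no later `m` falls below. Conditioning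
on the next variable, the value `0` keeps `c`, the value `m` replaces `c` by `m`, and the value `1`
fixes the maximum at `1`. Sorting by `m` is what makes the second case correct. -/
theorem expectMaxT_ret (X : Fin n → ThreePoint) {l : List (Fin n)}
    (hl : l.Pairwise fun i j => (X i).m ≤ (X j).m) {c : ℝ} (hc : 0 ≤ c)
    (hcl : ∀ i ∈ l, c ≤ (X i).m) :
    (expectMaxT X l 1 c).ret = listExpect (l.map X) fun xs => max c (listMax xs) := by
  induction l generalizing c with
  | nil => simp [expectMaxT, listExpect, hc]
  | cons i l ih =>
    rw [List.pairwise_cons] at hl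
    have hci : c ≤ (X i).m := hcl i (by simp)
    have h1 := ih hl.2 hc fun j hj => hcl j (by simp [hj])
    have h2 := ih hl.2 (X i).m_nonneg hl.1
    have hlin := expectMaxT_linear X l (1 - (X i).p - (X i).q) (X i).p 1 c 1 (X i).m
    rw [h1, h2] at hlin
    have hexp : listExpect ((i :: l).map X) (fun xs => max c (listMax xs)) =
        (1 - (X i).p - (X i).q) * listExpect (l.map X) (fun xs => max c (listMax xs)) +
        (X i).p * listExpect (l.map X) (fun xs => max (X i).m (listMax xs)) +
        (X i).q * listExpect (l.map X) (fun xs => max 1 (listMax xs)) := by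
      have e0 : ∀ xs, max c (max 0 (listMax xs)) = max c (listMax xs) := fun xs => by
        rw [max_eq_right (listMax_nonneg xs)]
      have e1 : ∀ xs, max c (max (X i).m (listMax xs)) = max (X i).m (listMax xs) := fun xs => by
        rw [← max_assoc, max_eq_right hci]
      have e2 : ∀ xs, max c (max 1 (listMax xs)) = max 1 (listMax xs) := fun xs => by
        rw [← max_assoc, max_eq_right (hci.trans (X i).m_le_one)]
      simp [listExpect, Fin.sum_univ_three, ThreePoint.prob, ThreePoint.val, e0, e1, e2]
    rw [hexp, listExpect_max_one, expectMaxT_cons_ret]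
    -- The new state is `(1 - p - q) • (1, c) + p • (1, m)`; the outcome `1` leaves the state and is
    -- restored through `1 - P`.
    have e3 : (1 - (X i).q) * 1 = (1 - (X i).p - (X i).q) * 1 + (X i).p * 1 := by ring
    have e4 : (X i).p * (X i).m * 1 + (1 - (X i).p - (X i).q) * c =
      (1 - (X i).p - (X i).q) * c + (X i).p * (X i).m := by ring
    rw [e3, e4]
    linarith

theorem maxParamT_ret (hn : 1 ≤ n) (X : Fin n → ThreePoint) :
    (maxParamT X).ret = maxParam X := by
  have hp := sortByT_perm (fun i : Fin n => (return (X i).m : Timed ℝ)) (List.finRange n)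
  obtain ⟨σ, hσ⟩ := exists_perm_ofFn hp
  rw [maxParam_eq hn X σ, hσ]
  simp only [maxParamT, Timed.ret_bind, ret_rdiv]
  congr 1
  rw [expectMaxT_ret X (sortByT_pairwise (fun i : Fin n => (return (X i).m : Timed ℝ)) _) le_rfl
    fun i _ => (X i).m_nonneg]
  congr 1
  funext xs
  exact max_eq_right (listMax_nonneg xs)

/-! ## Nodes -/

/-- The stored values of a node are correct. -/
structure Node.IsValid (X : Fin n → ThreePoint) (N : Node n) : Prop where
  s_eq : N.s = firstValue X N.S
  v_eq : N.v = seqValue X N.T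

/-- The pair of sequences of a node. -/
def Node.pair (N : Node n) : SeqPair n := (N.S, N.T)

theorem Node.IsValid.v_nonneg {X : Fin n → ThreePoint} {N : Node n} (h : N.IsValid X) :
    0 ≤ N.v := h.v_eq ▸ seqValue_nonneg X _

theorem Node.IsValid.pushS {X : Fin n → ThreePoint} {N : Node n} (h : N.IsValid X) (i : Fin n) :
    (pushS X i N).ret.IsValid X :=
  ⟨by simp [OptimalOrdering.pushS, firstValue, h.s_eq], h.v_eq⟩

theorem Node.IsValid.pushT {X : Fin n → ThreePoint} {N : Node n} (h : N.IsValid X) (i : Fin n) :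
    (pushT X i N).ret.IsValid X :=
  ⟨h.s_eq, by simp [OptimalOrdering.pushT, seqValue, h.v_eq, expMaxT_ret]⟩

theorem pushT_v (X : Fin n → ThreePoint) (i : Fin n) (N : Node n) :
    (pushT X i N).ret.v = (X i).expMax N.v := expMaxT_ret _ _

/-- A list of nodes is sorted by decreasing `v`. -/
abbrev NodesSorted (l : List (Node n)) : Prop := l.Pairwise fun M N => N.v ≤ M.v

theorem mergeT_perm (A B : List (Node n)) : (mergeT A B).ret.Perm (A ++ B) := by
  induction A, B using mergeT.induct with
  | case1 B => simp [mergeT]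
  | case2 A h => cases A <;> simp [mergeT]
  | case3 a A b B ih1 ih2 =>
    rw [mergeT]
    simp only [Timed.ret_bind, ret_rle]
    split_ifs
    · exact ih1.cons a
    · exact (ih2.cons b).trans List.perm_middle.symm

theorem mergeT_sorted {A B : List (Node n)} (hA : NodesSorted A) (hB : NodesSorted B) :
    NodesSorted (mergeT A B).ret := by
  induction A, B using mergeT.induct with
  | case1 B => simpa [mergeT] using hB
  | case2 A h => cases A <;> simp_all [mergeT]
  | case3 a A b B ih1 ih2 =>
    have hA' := List.pairwise_cons.1 hA
    have hB' := List.pairwise_cons.1 hB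
    rw [mergeT]
    simp only [Timed.ret_bind, ret_rle]
    split_ifs with h
    · refine List.pairwise_cons.2 ⟨fun N hN => ?_, ih1 hA'.2 hB⟩
      rcases List.mem_append.1 ((mergeT_perm _ _).subset hN) with hN | hN
      · exact hA'.1 N hN
      · rcases List.mem_cons.1 hN with rfl | hN
        · exact h
        · exact (hB'.1 N hN).trans h
    · refine List.pairwise_cons.2 ⟨fun N hN => ?_, ih2 hA hB'.2⟩
      have h := (not_le.1 h).le
      rcases List.mem_append.1 ((mergeT_perm _ _).subset hN) with hN | hN
      · rcases List.mem_cons.1 hN with rfl | hN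
        · exact h
        · exact (hA'.1 N hN).trans h
      · exact hB'.1 N hN

theorem maxT_spec (l : List (Node n)) (mx : ℝ) :
    mx ≤ (maxT l mx).ret ∧ (∀ N ∈ l, N.v ≤ (maxT l mx).ret) ∧
      ((maxT l mx).ret = mx ∨ ∃ N ∈ l, (maxT l mx).ret = N.v) := by
  induction l generalizing mx with
  | nil => simp [maxT]
  | cons N l ih =>
    obtain ⟨h1, h2, h3⟩ := ih (max mx N.v)
    have h : (maxT (N :: l) mx).ret = (maxT l (max mx N.v)).ret := rfl
    rw [h]
    refine ⟨(le_max_left _ _).trans h1, fun M hM => ?_, ?_⟩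
    · rcases List.mem_cons.1 hM with rfl | hM
      · exact (le_max_right _ _).trans h1
      · exact h2 M hM
    · rcases h3 with h3 | ⟨M, hM, h3⟩
      · rcases max_choice mx N.v with h4 | h4
        · exact Or.inl (h3.trans h4)
        · exact Or.inr ⟨N, by simp, h3.trans h4⟩
      · exact Or.inr ⟨M, by simp [hM], h3⟩

/-! ## Selecting the best members of the buckets -/

/-- `o` is a member of `l` with the largest `s`, or `none` if `l` is empty. -/
def IsBest (o : Option (Node n)) (l : List (Node n)) : Prop :=
  (l = [] ∧ o = none) ∨ ∃ M ∈ l, o = some M ∧ ∀ N ∈ l, N.s ≤ M.s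

theorem isBest_toList (o : Option (Node n)) : IsBest o o.toList := by
  cases o with
  | none => exact Or.inl ⟨rfl, rfl⟩
  | some M => exact Or.inr ⟨M, by simp, rfl, by simp⟩

theorem betterT_spec (best : Option (Node n)) (N : Node n) :
    (betterT best N).ret ∈ best.toList ++ [N] ∧
      ∀ K ∈ best.toList ++ [N], K.s ≤ (betterT best N).ret.s := by
  cases best with
  | none => simp [betterT]
  | some M =>
    simp only [betterT, Timed.ret_bind, ret_rle]
    split_ifs with h
    · simp [h]
    · simp [(not_le.1 h).le]

theorem IsBest.of_betterT {best o : Option (Node n)} {N : Node n} {l : List (Node n)}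
    (h : IsBest o ((some (betterT best N).ret).toList ++ l)) :
    IsBest o (best.toList ++ N :: l) := by
  obtain ⟨h1, h2⟩ := betterT_spec best N
  have hsplit : best.toList ++ N :: l = (best.toList ++ [N]) ++ l := by simp
  rw [hsplit]
  rcases h with ⟨h, _⟩ | ⟨M, hM, rfl, hb⟩
  · simp at h
  · refine Or.inr ⟨M, ?_, rfl, fun K hK => ?_⟩
    · rcases List.mem_append.1 hM with hM | hM
      · rw [Option.toList_some, List.mem_singleton] at hM
        exact List.mem_append_left _ (hM ▸ h1)
      · exact List.mem_append_right _ hM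
    · rcases List.mem_append.1 hK with hK | hK
      · exact (h2 K hK).trans (hb _ (by simp))
      · exact hb K (List.mem_append_right _ hK)

/-- Because the list is sorted by decreasing `v`, the members above `g` form an initial segment, so
stopping at the first failure loses none of them. -/
theorem takeBucketT_spec (g : ℝ) (best : Option (Node n)) {l : List (Node n)}
    (hl : NodesSorted l) :
    ∃ pre, l = pre ++ (takeBucketT g best l).ret.2 ∧ (∀ N ∈ pre, g < N.v) ∧
      (∀ N ∈ (takeBucketT g best l).ret.2, N.v ≤ g) ∧
      IsBest (takeBucketT g best l).ret.1 (best.toList ++ pre) := by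
  induction l generalizing best with
  | nil => exact ⟨[], by simp [takeBucketT], by simp, by simp [takeBucketT], by
      simpa [takeBucketT] using isBest_toList best⟩
  | cons N l ih =>
    rw [NodesSorted, List.pairwise_cons] at hl
    simp only [takeBucketT, Timed.ret_bind, ret_rle]
    split_ifs with h
    · refine ⟨[], rfl, by simp, fun M hM => ?_, by simpa using isBest_toList best⟩
      rcases List.mem_cons.1 hM with rfl | hM
      · exact h
      · exact (hl.1 M hM).trans h
    · obtain ⟨pre, h1, h2, h3, h4⟩ := ih (some (betterT best N).ret) hl.2
      refine ⟨N :: pre, congrArg (N :: ·) h1, fun M hM => ?_, h3, h4.of_betterT⟩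
      rcases List.mem_cons.1 hM with rfl | hM
      · exact not_le.1 h
      · exact h2 M hM

theorem emptyBucketT_spec (best : Option (Node n)) (l : List (Node n)) :
    ∃ o, IsBest o (best.toList ++ l.filter fun N => N.T.isEmpty) ∧
      (emptyBucketT best l).ret = o.toList := by
  induction l generalizing best with
  | nil => exact ⟨best, by simpa using isBest_toList best, by cases best <;> rfl⟩
  | cons N l ih =>
    cases hT : N.T with
    | nil =>
      obtain ⟨o, h1, h2⟩ := ih (some (betterT best N).ret)
      refine ⟨o, ?_, ?_⟩
      · rw [List.filter_cons, hT]
        exact h1.of_betterT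
      · cases best <;> simpa [emptyBucketT, hT] using h2
    | cons i T =>
      obtain ⟨o, h1, h2⟩ := ih best
      refine ⟨o, ?_, ?_⟩
      · rw [List.filter_cons, hT]
        exact h1
      · cases best <;> simpa [emptyBucketT, hT] using h2

theorem gridT_ret_eq_nil {ρ θ x : ℝ} (h : (gridT ρ θ x).ret = []) :
    ¬(0 < θ ∧ 0 < ρ ∧ ρ < 1 ∧ θ ≤ x) := by
  intro hc
  rw [gridT, dif_pos hc] at h
  simp at h

theorem gridT_ret_eq_cons {ρ θ x g : ℝ} {grid : List ℝ} (h : (gridT ρ θ x).ret = g :: grid) :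
    (0 < θ ∧ 0 < ρ ∧ ρ < 1 ∧ θ ≤ x) ∧ g = x ∧ (gridT ρ θ (ρ * x)).ret = grid := by
  by_cases hc : 0 < θ ∧ 0 < ρ ∧ ρ < 1 ∧ θ ≤ x
  · rw [gridT, dif_pos hc] at h
    simp only [List.cons.injEq] at h
    exact ⟨hc, h.1.symm, h.2⟩
  · rw [gridT, dif_neg hc] at h
    simp at h

/-- The node `N` of `l` lies in the bucket with index `j + 1` for the maximum `hi`. -/
def InBucket (ρ θ hi : ℝ) (l : List (Node n)) (j : ℕ) (N : Node n) : Prop :=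
  N ∈ l ∧ θ ≤ ρ ^ (j + 1) * hi ∧ ρ ^ (j + 1) * hi < N.v ∧ N.v ≤ ρ ^ j * hi

/-- Removing the top bucket leaves the same problem with `hi` replaced by `ρ * hi` and bucket
indices lowered by one. The alternative `hi = 0` covers `θ = 0`, when the computed grid is empty: no
bucket can then have a member. Sortedness of the result is carried along because the next iteration
merges it. -/
theorem bucketsT_spec {ρ θ : ℝ} (hρ0 : 0 < ρ) (hρ1 : ρ < 1) (tail : List (Node n))
    {hi : ℝ} {l : List (Node n)} (hl : NodesSorted l) (hhi : ∀ N ∈ l, N.v ≤ hi) (h0 : 0 ≤ hi)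
    (hθ : 0 < θ ∨ hi = 0) :
    ∃ c : ℕ → Node n,
      (∀ j, (∃ N, InBucket ρ θ hi l j N) → InBucket ρ θ hi l j (c j) ∧
        ∀ N, InBucket ρ θ hi l j N → N.s ≤ (c j).s) ∧
      (∀ N, N ∈ (bucketsT tail (gridT ρ θ (ρ * hi)).ret l).ret ↔
        N ∈ tail ∨ ∃ j, (∃ M, InBucket ρ θ hi l j M) ∧ N = c j) ∧
      (NodesSorted tail → (∀ M ∈ tail, ∀ N ∈ l, M.v ≤ N.v) →
        NodesSorted (bucketsT tail (gridT ρ θ (ρ * hi)).ret l).ret) := by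
  induction hg : (gridT ρ θ (ρ * hi)).ret generalizing hi l with
  | nil =>
    have hemp : ∀ j N, ¬InBucket ρ θ hi l j N := by
      rintro j N ⟨hN, h1, h2, _⟩
      refine gridT_ret_eq_nil hg ?_
      rcases hθ with hθ | rfl
      · refine ⟨hθ, hρ0, hρ1, h1.trans ?_⟩
        rw [pow_succ, mul_assoc]
        exact mul_le_of_le_one_left (mul_nonneg hρ0.le h0) (pow_le_one₀ hρ0.le hρ1.le)
      · rw [mul_zero] at h2
        exact absurd (hhi N hN) (not_le.2 h2)
    refine ⟨fun _ => ⟨[], [], 0, 0⟩, fun j ⟨N, hN⟩ => absurd hN (hemp j N), fun N => ?_,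
      fun ht _ => ht⟩
    simp [bucketsT, hemp]
  | cons g grid ih =>
    obtain ⟨⟨hθ', -, -, hle⟩, rfl, hg'⟩ := gridT_ret_eq_cons hg
    obtain ⟨pre, hsplit, hpre, hrest, hbest⟩ := takeBucketT_spec (ρ * hi) none hl
    have hret : (bucketsT tail (ρ * hi :: grid) l).ret =
        (takeBucketT (ρ * hi) none l).ret.1.toList ++
          (bucketsT tail grid (takeBucketT (ρ * hi) none l).ret.2).ret := by
      simp only [bucketsT, Timed.ret_bind]
      cases (takeBucketT (ρ * hi) none l).ret.1 <;> rfl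
    rw [hret]
    set o := (takeBucketT (ρ * hi) none l).ret.1
    set rest := (takeBucketT (ρ * hi) none l).ret.2
    rw [Option.toList_none, List.nil_append] at hbest
    obtain ⟨c, hc1, hc2, hc3⟩ := ih (hi := ρ * hi) (l := rest)
      (hl.sublist (hsplit ▸ List.sublist_append_right _ _)) hrest (by positivity)
      (Or.inl hθ') hg'
    have hzero : ∀ N, InBucket ρ θ hi l 0 N ↔ N ∈ pre := by
      intro N
      simp only [InBucket, zero_add, pow_one, pow_zero, one_mul]
      constructor
      · rintro ⟨hN, -, h2, -⟩
        rw [hsplit] at hN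
        rcases List.mem_append.1 hN with hN | hN
        · exact hN
        · exact absurd (hrest N hN) (not_le.2 h2)
      · intro hN
        have hNl : N ∈ l := hsplit ▸ List.mem_append_left _ hN
        exact ⟨hNl, hle, hpre N hN, hhi N hNl⟩
    have hsucc : ∀ j N, InBucket ρ θ hi l (j + 1) N ↔ InBucket ρ θ (ρ * hi) rest j N := by
      intro j N
      have e1 : ρ ^ (j + 1 + 1) * hi = ρ ^ (j + 1) * (ρ * hi) := by ring
      have e2 : ρ ^ (j + 1) * hi = ρ ^ j * (ρ * hi) := by ring
      unfold InBucket
      rw [e1, e2]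
      refine and_congr_left fun ⟨_, _, h3⟩ => ⟨fun hN => ?_, fun hN => ?_⟩
      · rw [hsplit] at hN
        rcases List.mem_append.1 hN with hN | hN
        · have h4 := hpre N hN
          -- A member of `pre` exceeds `ρ * hi`, and so it exceeds the upper end of every later
          -- bucket.
          have h5 := mul_le_mul_of_nonneg_right (pow_le_one₀ (n := j) hρ0.le hρ1.le)
            (mul_nonneg hρ0.le h0)
          linarith
        · exact hN
      · exact hsplit ▸ List.mem_append_right _ hN
    have hmem : ∀ N ∈ (bucketsT tail grid rest).ret, N ∈ tail ∨ N ∈ rest := by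
      intro N hN
      rcases (hc2 N).1 hN with hN | ⟨j, hj, rfl⟩
      · exact Or.inl hN
      · exact Or.inr (hc1 j hj).1.1
    rcases hbest with ⟨hpe, ho⟩ | ⟨M, hM, ho, hMb⟩
    · refine ⟨fun j => Nat.casesOn j ⟨[], [], 0, 0⟩ c, ?_, ?_, ?_⟩
      · rintro (_ | j) ⟨N, hN⟩
        · rw [hzero, hpe] at hN
          simp at hN
        · simp only [hsucc] at hN ⊢
          exact hc1 j ⟨N, hN⟩
      · intro N
        rw [ho, Option.toList_none, List.nil_append, hc2]
        refine or_congr_right ⟨fun ⟨j, hj⟩ => ⟨j + 1, by simpa only [hsucc] using hj⟩, ?_⟩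
        rintro ⟨_ | j, ⟨M, hM⟩, hj⟩
        · rw [hzero, hpe] at hM
          simp at hM
        · exact ⟨j, ⟨M, (hsucc j M).1 hM⟩, hj⟩
      · intro ht1 ht2
        rw [ho, Option.toList_none, List.nil_append]
        exact hc3 ht1 fun M hM N hN => ht2 M hM N (hsplit ▸ List.mem_append_right _ hN)
    · refine ⟨fun j => Nat.casesOn j M c, ?_, ?_, ?_⟩
      · rintro (_ | j) ⟨N, hN⟩
        · simp only [hzero]
          exact ⟨hM, hMb⟩
        · simp only [hsucc] at hN ⊢
          exact hc1 j ⟨N, hN⟩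
      · intro N
        rw [ho, Option.toList_some, List.mem_append, List.mem_singleton, hc2]
        constructor
        · rintro (rfl | hN | ⟨j, hj⟩)
          · exact Or.inr ⟨0, ⟨N, (hzero N).2 hM⟩, rfl⟩
          · exact Or.inl hN
          · exact Or.inr ⟨j + 1, by simpa only [hsucc] using hj⟩
        · rintro (hN | ⟨_ | j, ⟨K, hK⟩, hj⟩)
          · exact Or.inr (Or.inl hN)
          · exact Or.inl hj
          · exact Or.inr (Or.inr ⟨j, ⟨K, (hsucc j K).1 hK⟩, hj⟩)
      · intro ht1 ht2
        rw [ho, Option.toList_some, List.singleton_append, NodesSorted, List.pairwise_cons]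
        refine ⟨fun N hN => ?_, hc3 ht1 fun M hM N hN =>
          ht2 M hM N (hsplit ▸ List.mem_append_right _ hN)⟩
        rcases hmem N hN with hN | hN
        · exact ht2 N hN M (hsplit ▸ List.mem_append_left _ hM)
        · exact (hrest N hN).trans (hpre M hM).le

/-! ## TRIM -/

/-- The set of the pairs in a list of nodes. -/
def pairSet (L : List (Node n)) : Set (SeqPair n) := {P | ∃ N ∈ L, N.pair = P}

/-- Starting the maximum at `0` is harmless because all values are nonnegative. For the empty list
it agrees with the default `sSup ∅ = 0`. -/
theorem maxT_eq_maxValue (X : Fin n → ThreePoint) {l : List (Node n)}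
    (hl : ∀ N ∈ l, N.IsValid X) : (maxT l 0).ret = maxValue X (pairSet l) := by
  obtain ⟨h1, h2, h3⟩ := maxT_spec l 0
  rcases l.eq_nil_or_concat' with rfl | ⟨l', K, rfl⟩
  · simp [maxT, maxValue, pairSet]
  · refine (IsGreatest.csSup_eq ⟨?_, ?_⟩).symm
    · rcases h3 with h3 | ⟨N, hN, h3⟩
      · have hK : K ∈ l' ++ [K] := by simp
        refine ⟨K.pair, ⟨K, hK, rfl⟩, ?_⟩
        have h4 := (hl K hK).v_nonneg
        have h5 := h2 K hK
        rw [h3] at h5 ⊢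
        exact (hl K hK).v_eq.symm.trans (le_antisymm h5 h4)
      · exact ⟨N.pair, ⟨N, hN, rfl⟩, (hl N hN).v_eq.symm.trans h3.symm⟩
    · rintro _ ⟨_, ⟨N, hN, rfl⟩, rfl⟩
      exact (hl N hN).v_eq.symm.trans_le (h2 N hN)

theorem trimT_spec {X : Fin n → ThreePoint} {ε : ℝ} (hn : 1 ≤ n) (h0 : 0 < ε) (h1 : ε < 1)
    {l : List (Node n)} (hv : ∀ N ∈ l, N.IsValid X) (hs : NodesSorted l)
    (hθ : 0 < threshold X ε ∨ ∀ N ∈ l, N.v = 0) :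
    (trimT (gridRatio n ε) (threshold X ε) l).ret ⊆ l ∧
      NodesSorted (trimT (gridRatio n ε) (threshold X ε) l).ret ∧
      IsTrim X ε (pairSet l) (pairSet (trimT (gridRatio n ε) (threshold X ε) l).ret) := by
  obtain ⟨hr0, hr1⟩ := gridRatio_bounds hn h0 h1
  set ρ := gridRatio n ε with hρ
  set θ := threshold X ε with hθdef
  obtain ⟨hm1, hm2, hm3⟩ := maxT_spec l 0
  have hmv := maxT_eq_maxValue X hv
  obtain ⟨o, ho, hoe⟩ := emptyBucketT_spec none l
  rw [Option.toList_none, List.nil_append] at ho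
  have hret : (trimT ρ θ l).ret = (bucketsT o.toList (gridT ρ θ (ρ * (maxT l 0).ret)).ret l).ret := by
    simp only [trimT, Timed.ret_bind, ret_rmul, hoe]
  have hθ' : 0 < θ ∨ (maxT l 0).ret = 0 := by
    refine hθ.imp_right fun h => ?_
    rcases hm3 with h3 | ⟨N, hN, h3⟩
    · exact h3
    · exact h3.trans (h N hN)
  obtain ⟨c, hc1, hc2, hc3⟩ := bucketsT_spec hr0 hr1 o.toList hs hm2 hm1 hθ'
  rw [hret]
  have hbucket : ∀ j N, InBucket ρ θ (maxT l 0).ret l j N →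
      N.pair ∈ bucket X ε (pairSet l) (j + 1) := by
    rintro j N ⟨hN, hb⟩
    rw [hmv, (hv N hN).v_eq] at hb
    exact ⟨⟨N, hN, rfl⟩, hb⟩
  have hbucket' : ∀ j P, P ∈ bucket X ε (pairSet l) (j + 1) →
      ∃ N, InBucket ρ θ (maxT l 0).ret l j N ∧ N.pair = P := by
    rintro j P ⟨⟨N, hN, rfl⟩, hb⟩
    refine ⟨N, ⟨hN, ?_⟩, rfl⟩
    rw [hmv, (hv N hN).v_eq]
    exact hb
  have hfil : ∀ N, N ∈ l.filter (fun N => N.T.isEmpty) ↔ N ∈ l ∧ N.T = [] := by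
    intro N
    rw [List.mem_filter, List.isEmpty_iff]
  have htail : ∀ N ∈ o.toList, N ∈ l ∧ N.T = [] := by
    intro N hN
    rcases ho with ⟨_, rfl⟩ | ⟨M, hM, rfl, _⟩
    · simp at hN
    · rw [Option.toList_some, List.mem_singleton] at hN
      exact (hfil N).1 (hN ▸ hM)
  refine ⟨fun N hN => ?_, hc3 ?_ ?_, ?_⟩
  · rcases (hc2 N).1 hN with hN | ⟨j, hj, rfl⟩
    · exact (htail N hN).1
    · exact (hc1 j hj).1.1
  · cases o <;> simp
  · intro M hM N hN
    obtain ⟨hM1, hM2⟩ := htail M hM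
    rw [(hv M hM1).v_eq, hM2]
    exact (hv N hN).v_nonneg
  -- Index `0` selects the best pair with `T = ∅`; the default `([], [])` is never used when `B_0`
  -- is nonempty. The remaining indices are those of the grid buckets, shifted by one.
  · refine ⟨fun j => Nat.casesOn j ((o.map Node.pair).getD ([], [])) fun j => (c j).pair, ?_, ?_⟩
    · rintro (_ | j) ⟨P, hP⟩
      · obtain ⟨⟨N, hN, rfl⟩, hT⟩ := hP
        have hNf := (hfil N).2 ⟨hN, hT⟩
        rcases ho with ⟨he, _⟩ | ⟨M, hM, rfl, hb⟩
        · rw [he] at hNf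
          simp at hNf
        · obtain ⟨hM1, hM2⟩ := (hfil M).1 hM
          refine ⟨⟨⟨M, hM1, rfl⟩, hM2⟩, ?_⟩
          rintro _ ⟨⟨K, hK, rfl⟩, hKT⟩
          have := hb K ((hfil K).2 ⟨hK, hKT⟩)
          rwa [(hv K hK).s_eq, (hv M hM1).s_eq] at this
      · obtain ⟨N, hN, rfl⟩ := hbucket' j P hP
        obtain ⟨h3, h4⟩ := hc1 j ⟨N, hN⟩
        refine ⟨hbucket j _ h3, fun Q hQ => ?_⟩
        obtain ⟨K, hK, rfl⟩ := hbucket' j Q hQ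
        have := h4 K hK
        rwa [(hv K hK.1).s_eq, (hv _ h3.1).s_eq] at this
    · ext P
      constructor
      · rintro ⟨N, hN, rfl⟩
        rcases (hc2 N).1 hN with hN | ⟨j, ⟨M, hM⟩, rfl⟩
        · obtain ⟨hN1, hN2⟩ := htail N hN
          refine ⟨0, ⟨N.pair, ⟨N, hN1, rfl⟩, hN2⟩, ?_⟩
          cases o with
          | none => simp at hN
          | some M =>
            rw [Option.toList_some, List.mem_singleton] at hN
            rw [hN]
            rfl
        · exact ⟨j + 1, ⟨M.pair, hbucket j M hM⟩, rfl⟩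
      · rintro ⟨_ | j, ⟨Q, hQ⟩, rfl⟩
        · obtain ⟨⟨N, hN, rfl⟩, hT⟩ := hQ
          have hNf := (hfil N).2 ⟨hN, hT⟩
          rcases ho with ⟨he, _⟩ | ⟨M, hM, rfl, hb⟩
          · rw [he] at hNf
            simp at hNf
          · exact ⟨M, (hc2 M).2 (Or.inl (by simp)), rfl⟩
        · obtain ⟨N, hN, rfl⟩ := hbucket' j Q hQ
          exact ⟨c j, (hc2 _).2 (Or.inr ⟨j, ⟨N, hN⟩, rfl⟩), rfl⟩

/-! ## The main loop -/

/-- The lists that are merged in an iteration of the main loop. -/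
noncomputable def expandNodes (X : Fin n → ThreePoint) (k : Fin n) (L : List (Node n)) :
    List (Node n) :=
  (mergeT (L.map fun N => (pushS X k N).ret) (L.map fun N => (pushT X k N).ret)).ret

/-- The result of an iteration of the main loop. -/
noncomputable def loopStep (X : Fin n → ThreePoint) (ρ θ : ℝ) (k : Fin n) (L : List (Node n)) :
    List (Node n) :=
  (trimT ρ θ (expandNodes X k L)).ret

theorem loopT_cons_ret (X : Fin n → ThreePoint) (ρ θ : ℝ) (k : Fin n) (ks : List (Fin n))
    (L : List (Node n)) : (loopT X ρ θ (k :: ks) L).ret =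
      (loopT X ρ θ ks (loopStep X ρ θ k L)).ret := by
  simp only [loopT, Timed.ret_bind, mapT_ret]
  rfl

/-- The program recurses on the first variable still to come, whereas the invariant is proved by
adding the last processed one; this converts between the two. -/
theorem loopT_append_singleton_ret (X : Fin n → ThreePoint) (ρ θ : ℝ) (ks : List (Fin n))
    (k : Fin n) (L : List (Node n)) :
    (loopT X ρ θ (ks ++ [k]) L).ret = loopStep X ρ θ k (loopT X ρ θ ks L).ret := by
  induction ks generalizing L with
  | nil => exact loopT_cons_ret X ρ θ k [] L
  | cons i ks ih => rw [List.cons_append, loopT_cons_ret, loopT_cons_ret, ih]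

/-- The invariant of the main loop, when `o` holds the variables processed so far. -/
structure NodesGood (X : Fin n → ThreePoint) (o : List (Fin n)) (L : List (Node n)) : Prop where
  valid : ∀ N ∈ L, N.IsValid X
  perm : ∀ N ∈ L, (N.S ++ N.T).Perm o
  sublist : ∀ N ∈ L, N.T.Sublist o
  sorted : NodesSorted L

theorem mem_expandNodes {X : Fin n → ThreePoint} {k : Fin n} {L : List (Node n)} {N : Node n} :
    N ∈ expandNodes X k L ↔
      (∃ M ∈ L, (pushS X k M).ret = N) ∨ ∃ M ∈ L, (pushT X k M).ret = N := by
  rw [expandNodes, (mergeT_perm _ _).mem_iff, List.mem_append, List.mem_map, List.mem_map]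

/-- Both lists to be merged are already sorted: `pushS` leaves `v` unchanged and `pushT` applies the
monotone map `expMax`. No sorting is needed inside the loop. -/
theorem NodesGood.expandNodes {X : Fin n → ThreePoint} {o : List (Fin n)} {L : List (Node n)}
    (h : NodesGood X o L) (k : Fin n) : NodesGood X (k :: o) (expandNodes X k L) where
  valid N hN := by
    obtain ⟨M, hM, rfl⟩ | ⟨M, hM, rfl⟩ := mem_expandNodes.1 hN
    · exact (h.valid M hM).pushS k
    · exact (h.valid M hM).pushT k
  perm N hN := by
    obtain ⟨M, hM, rfl⟩ | ⟨M, hM, rfl⟩ := mem_expandNodes.1 hN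
    · exact (h.perm M hM).cons k
    · exact List.perm_middle.trans ((h.perm M hM).cons k)
  sublist N hN := by
    obtain ⟨M, hM, rfl⟩ | ⟨M, hM, rfl⟩ := mem_expandNodes.1 hN
    · exact (h.sublist M hM).cons k
    · exact (h.sublist M hM).cons_cons k
  sorted := by
    refine mergeT_sorted ?_ ?_
    · rw [NodesSorted, List.pairwise_map]
      exact h.sorted
    · rw [NodesSorted, List.pairwise_map]
      exact h.sorted.imp fun {M N} hMN => by
        rw [pushT_v, pushT_v]
        exact (X k).expMax_mono hMN

theorem pairSet_expandNodes (X : Fin n → ThreePoint) (k : Fin n) (L : List (Node n)) :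
    pairSet (expandNodes X k L) = expand k (pairSet L) := by
  ext P
  constructor
  · rintro ⟨N, hN, rfl⟩
    obtain ⟨M, hM, rfl⟩ | ⟨M, hM, rfl⟩ := mem_expandNodes.1 hN
    · exact ⟨M.pair, ⟨M, hM, rfl⟩, Or.inl rfl⟩
    · exact ⟨M.pair, ⟨M, hM, rfl⟩, Or.inr rfl⟩
  · rintro ⟨_, ⟨M, hM, rfl⟩, rfl | rfl⟩
    · exact ⟨_, mem_expandNodes.2 (Or.inl ⟨M, hM, rfl⟩), rfl⟩
    · exact ⟨_, mem_expandNodes.2 (Or.inr ⟨M, hM, rfl⟩), rfl⟩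

/-- This bound has two uses: it makes all values vanish when `MAX = 0`, and it limits the range that
the grid has to cover. -/
theorem seqValue_le_maxParam (hn : 1 ≤ n) (X : Fin n → ThreePoint) {t o : List (Fin n)}
    (ho : o.Perm (List.finRange n)) (ht : t.Sublist o) : seqValue X t ≤ 2 * maxParam X := by
  obtain ⟨σ, rfl⟩ := exists_perm_ofFn ho
  rw [maxParam_eq hn X σ]
  linarith [seqValue_le_listExpect X ht]

theorem NodesGood.loopStep {X : Fin n → ThreePoint} {ε : ℝ} (hn : 1 ≤ n) (h0 : 0 < ε)
    (h1 : ε < 1) {o t : List (Fin n)} {k : Fin n} {L : List (Node n)} (h : NodesGood X o L)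
    (ho : (t ++ k :: o).Perm (List.finRange n)) :
    NodesGood X (k :: o) (loopStep X (gridRatio n ε) (threshold X ε) k L) ∧
      IsTrim X ε (expand k (pairSet L))
        (pairSet (loopStep X (gridRatio n ε) (threshold X ε) k L)) := by
  have hg := h.expandNodes k
  obtain ⟨h2, h3, h4⟩ := trimT_spec hn h0 h1 hg.valid hg.sorted (by
    rcases (maxParam_nonneg hn X).lt_or_eq with hM | hM
    · left
      unfold threshold
      have : (0 : ℝ) < n := by exact_mod_cast hn
      positivity
    -- If `MAX = 0` the threshold is `0` and the program uses no grid, but then every `V(T)` is `0`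
    -- as well.
    · right
      intro N hN
      refine le_antisymm ?_ (hg.valid N hN).v_nonneg
      rw [(hg.valid N hN).v_eq]
      refine (seqValue_le_maxParam hn X ho
        ((hg.sublist N hN).trans (List.sublist_append_right _ _))).trans ?_
      rw [← hM, mul_zero])
  rw [pairSet_expandNodes] at h4
  exact ⟨⟨fun N hN => hg.valid N (h2 hN), fun N hN => hg.perm N (h2 hN),
    fun N hN => hg.sublist N (h2 hN), h3⟩, h4⟩

/-- The nodes after `k` iterations of the main loop. -/
noncomputable def nodesAt (X : Fin n → ThreePoint) (ε : ℝ) (π : Equiv.Perm (Fin n)) (k : ℕ) :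
    List (Node n) :=
  (loopT X (gridRatio n ε) (threshold X ε) ((List.ofFn π).take k) [⟨[], [], 0, 0⟩]).ret

theorem nodesAt_succ (X : Fin n → ThreePoint) (ε : ℝ) (π : Equiv.Perm (Fin n)) (k : Fin n) :
    nodesAt X ε π (k + 1) =
      loopStep X (gridRatio n ε) (threshold X ε) (π k) (nodesAt X ε π k) := by
  unfold nodesAt
  rw [← loopT_append_singleton_ret, List.take_add_one]
  simp

theorem drop_append_processed_perm (π : Equiv.Perm (Fin n)) (k : ℕ) :
    (((List.ofFn π).drop k) ++ processed π k).Perm (List.finRange n) := by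
  have h1 : (((List.ofFn π).drop k) ++ processed π k).Perm (List.ofFn π) := by
    refine ((List.reverse_perm _).append_left _).trans ?_
    refine List.perm_append_comm.trans ?_
    rw [List.take_append_drop]
  refine h1.trans ((List.perm_ext_iff_of_nodup (List.nodup_ofFn.2 π.injective)
    (List.nodup_finRange n)).2 fun i => ?_)
  simp only [List.mem_ofFn, List.mem_finRange]
  exact iff_of_true (π.surjective i) trivial

theorem nodesAt_good {X : Fin n → ThreePoint} {ε : ℝ} (hn : 1 ≤ n) (h0 : 0 < ε)
    (h1 : ε < 1) (π : Equiv.Perm (Fin n)) (k : ℕ) (hk : k ≤ n) :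
    NodesGood X (processed π k) (nodesAt X ε π k) := by
  induction k with
  | zero =>
    have h : nodesAt X ε π 0 = [⟨[], [], 0, 0⟩] := rfl
    rw [h, processed_zero]
    constructor <;> simp
    exact ⟨rfl, rfl⟩
  | succ k ih =>
    have e1 := processed_succ π ⟨k, hk⟩
    have e2 := nodesAt_succ X ε π ⟨k, hk⟩
    have e3 := drop_append_processed_perm π (k + 1)
    simp only at e1 e2
    rw [e1] at e3
    rw [e1, e2]
    exact ((ih (by omega)).loopStep hn h0 h1 e3).1

theorem isRun_nodesAt {X : Fin n → ThreePoint} {ε : ℝ} (hn : 1 ≤ n) (h0 : 0 < ε)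
    (h1 : ε < 1) {π : Equiv.Perm (Fin n)} (hπ : Monotone fun k => (X (π k)).condMean) :
    IsRun X ε π fun k => pairSet (nodesAt X ε π k) where
  sorted := hπ
  init := by
    have h : nodesAt X ε π 0 = [⟨[], [], 0, 0⟩] := rfl
    rw [h]
    ext P
    simp [pairSet, Node.pair, eq_comm]
  trim k := by
    have e3 := drop_append_processed_perm π (k + 1)
    rw [processed_succ] at e3
    simp only [nodesAt_succ]
    exact ((nodesAt_good hn h0 h1 π k k.2.le).loopStep hn h0 h1 e3).2

/-! ## The output of the program -/

theorem bestT_spec (X : Fin n → ThreePoint) (best : ℝ × SeqPair n) {L : List (Node n)}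
    (hL : ∀ N ∈ L, N.IsValid X) :
    ∃ w, best.1 ≤ w ∧ (∀ N ∈ L, seqValue X (N.S ++ N.T) ≤ w) ∧
      ((w = best.1 ∧ (bestT X best L).ret = best.2) ∨
        ∃ N ∈ L, (bestT X best L).ret = N.pair ∧ w = seqValue X (N.S ++ N.T)) := by
  induction L generalizing best with
  | nil => exact ⟨best.1, le_rfl, by simp, Or.inl ⟨rfl, rfl⟩⟩
  | cons N L ih =>
    have hN : (valueFromT X N.S N.v).ret = seqValue X (N.S ++ N.T) := by
      rw [(hL N (by simp)).v_eq, valueFromT_ret]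
    simp only [bestT, Timed.ret_bind, ret_rle, hN]
    have hL' : ∀ M ∈ L, M.IsValid X := fun M hM => hL M (by simp [hM])
    split_ifs with h
    · obtain ⟨w, h1, h2, h3⟩ := ih best hL'
      refine ⟨w, h1, ?_, h3.imp_right fun ⟨M, hM, h4⟩ => ⟨M, by simp [hM], h4⟩⟩
      intro M hM
      rcases List.mem_cons.1 hM with rfl | hM
      · exact h.trans h1
      · exact h2 M hM
    · have hlt := not_le.1 h
      obtain ⟨w, h1, h2, h3⟩ := ih (seqValue X (N.S ++ N.T), (N.S, N.T)) hL'
      refine ⟨w, hlt.le.trans h1, ?_, Or.inr ?_⟩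
      · intro M hM
        rcases List.mem_cons.1 hM with rfl | hM
        · exact h1
        · exact h2 M hM
      · rcases h3 with ⟨h3, h4⟩ | ⟨M, hM, h4⟩
        · exact ⟨N, by simp, h4, h3⟩
        · exact ⟨M, by simp [hM], h4⟩

theorem fptas_ret {X : Fin n → ThreePoint} {ε : ℝ} (hn : 1 ≤ n) {π : Equiv.Perm (Fin n)}
    (hπ : List.ofFn π = (sortByT (fun i => condMeanT (X i)) (List.finRange n)).ret) :
    (fptas X ε).ret = (bestT X (-1, ([], [])) (nodesAt X ε π n)).ret.1 ++
      (bestT X (-1, ([], [])) (nodesAt X ε π n)).ret.2 := by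
  simp only [fptas, Timed.ret_bind, appendT_ret, ret_rmul, ret_rdiv, ret_rsub, maxParamT_ret hn]
  rw [nodesAt, List.take_of_length_le (by simp), hπ]
  rfl

theorem exists_sorted_perm (X : Fin n → ThreePoint) : ∃ π : Equiv.Perm (Fin n),
    List.ofFn π = (sortByT (fun i => condMeanT (X i)) (List.finRange n)).ret ∧
    Monotone fun k => (X (π k)).condMean := by
  obtain ⟨π, hπ⟩ := exists_perm_ofFn
    (sortByT_perm (fun i => condMeanT (X i)) (List.finRange n))
  refine ⟨π, hπ, ?_⟩
  have h := sortByT_pairwise (fun i => condMeanT (X i)) (List.finRange n)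
  rw [← hπ, List.pairwise_ofFn] at h
  simp only [condMeanT_ret] at h
  intro i j hij
  rcases hij.lt_or_eq with hlt | rfl
  · exact h hlt
  · exact le_rfl

theorem fptas_isOutput {X : Fin n → ThreePoint} {ε : ℝ} (hn : 1 ≤ n) (h0 : 0 < ε)
    (h1 : ε < 1) : ∃ σ : Equiv.Perm (Fin n), (fptas X ε).ret = List.ofFn σ ∧ IsOutput X ε σ := by
  obtain ⟨π, hπ, hmono⟩ := exists_sorted_perm X
  have hrun := isRun_nodesAt hn h0 h1 hmono
  have hgood := nodesAt_good hn h0 h1 (X := X) π n le_rfl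
  obtain ⟨_, ⟨K, hK, rfl⟩, -⟩ := hrun.exists_nil_snd n le_rfl
  obtain ⟨w, -, h3, h4⟩ := bestT_spec X (-1, ([], [])) hgood.valid
  rw [fptas_ret hn hπ]
  rcases h4 with ⟨h4, -⟩ | ⟨N, hN, h4, h5⟩
  -- The initial candidate has value `-1`, below every `seqValue`, and the final collection is not
  -- empty, so the initial candidate cannot be returned.
  · have := h3 K hK
    rw [h4] at this
    linarith [seqValue_nonneg X (K.S ++ K.T)]
  · rw [h4]
    have hp := (drop_append_processed_perm π n)
    rw [List.drop_eq_nil_of_le (by simp), List.nil_append] at hp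
    obtain ⟨σ, hσ⟩ := exists_perm_ofFn ((hgood.perm N hN).trans hp)
    refine ⟨σ, hσ.symm, π, _, hrun, N.pair, ⟨N, hN, rfl⟩, hσ, ?_⟩
    rintro _ ⟨M, hM, rfl⟩
    exact (h3 M hM).trans h5.le

/-! ## Step counts of the components -/

theorem condMeanT_time (Y : ThreePoint) : (condMeanT Y).time ≤ 6 := by
  unfold condMeanT
  simp only [Timed.time_bind, time_rmul, time_radd, time_rle]
  split_ifs <;> simp only [Timed.time_bind, Timed.ret_pure, Timed.time_pure, time_radd, time_rle] <;>
    split_ifs <;> simp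

theorem expMaxT_time (Y : ThreePoint) (v : ℝ) : (expMaxT Y v).time = 10 := rfl

theorem mapT_time_le {α β : Type} (f : α → Timed β) {c : ℕ} (l : List α)
    (h : ∀ a ∈ l, (f a).time ≤ c) : (mapT f l).time ≤ (c + 1) * l.length + 1 := by
  induction l with
  | nil => simp [mapT]
  | cons a l ih =>
    have h1 := ih fun b hb => h b (by simp [hb])
    have h2 := h a (by simp)
    simp only [mapT, Timed.time_bind, time_tick, Timed.time_pure, List.length_cons]
    linarith

theorem appendT_time {α : Type} (l l' : List α) : (appendT l l').time = l.length + 1 := by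
  induction l with
  | nil => rfl
  | cons a l ih =>
    simp only [appendT, Timed.time_bind, time_tick, Timed.time_pure, List.length_cons, ih]
    omega

theorem insertT_time_le {α : Type} (a : ℝ × α) (l : List (ℝ × α)) :
    (insertT a l).time ≤ 2 * l.length + 1 := by
  induction l with
  | nil => simp [insertT]
  | cons b l ih =>
    simp only [insertT, Timed.time_bind, time_tick, time_rle, ret_rle, List.length_cons]
    split_ifs
    · simp only [Timed.time_pure]
      omega
    · simp only [Timed.time_bind, Timed.time_pure]
      omega

theorem sortT_time_le {α : Type} (l : List (ℝ × α)) :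
    (sortT l).time ≤ 2 * l.length ^ 2 + 2 * l.length + 1 := by
  induction l with
  | nil => simp [sortT]
  | cons a l ih =>
    have h := insertT_time_le a (sortT l).ret
    rw [(sortT_perm l).length_eq] at h
    simp only [sortT, Timed.time_bind, time_tick, List.length_cons]
    nlinarith

theorem sortByT_time_le {α : Type} (key : α → Timed ℝ) {c : ℕ} (l : List α)
    (h : ∀ a, (key a).time ≤ c) :
    (sortByT key l).time ≤ 2 * l.length ^ 2 + (c + 4) * l.length + 3 := by
  have h1 := mapT_time_le (fun a => do let e ← key a; return (e, a)) (c := c) l fun a _ => h a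
  have h2 := sortT_time_le (l.map fun a => ((key a).ret, a))
  have h3 := mapT_time_le (fun x : ℝ × α => do return x.2) (c := 0)
    (sortT (l.map fun a => ((key a).ret, a))).ret fun _ _ => le_rfl
  rw [(sortT_perm _).length_eq] at h3
  rw [List.length_map] at h2 h3
  simp only [sortByT, Timed.time_bind, mapT_ret, Timed.ret_bind, Timed.ret_pure] at h1 ⊢
  linarith

theorem expectMaxT_time (X : Fin n → ThreePoint) (l : List (Fin n)) (P G : ℝ) :
    (expectMaxT X l P G).time = 9 * l.length + 3 := by
  induction l generalizing P G with
  | nil => rfl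
  | cons i l ih =>
    simp only [expectMaxT, Timed.time_bind, time_tick, time_rmul, time_rsub, time_radd, ih,
      List.length_cons]
    omega

theorem maxParamT_time_le (X : Fin n → ThreePoint) :
    (maxParamT X).time ≤ 2 * n ^ 2 + 13 * n + 7 := by
  have h := sortByT_time_le (fun i : Fin n => (return (X i).m : Timed ℝ)) (c := 0)
    (List.finRange n) fun _ => le_rfl
  have h' := (sortByT_perm (fun i : Fin n => (return (X i).m : Timed ℝ))
    (List.finRange n)).length_eq
  rw [List.length_finRange] at h h'
  simp only [maxParamT, Timed.time_bind, expectMaxT_time, time_rdiv, h']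
  omega

theorem mergeT_time_le (A B : List (Node n)) :
    (mergeT A B).time ≤ 2 * (A.length + B.length) + 1 := by
  induction A, B using mergeT.induct with
  | case1 B => simp [mergeT]
  | case2 A h => cases A <;> simp [mergeT]
  | case3 a A b B ih1 ih2 =>
    rw [mergeT]
    simp only [Timed.time_bind, time_tick, time_rle, ret_rle, List.length_cons] at ih1 ih2 ⊢
    split_ifs <;> simp only [Timed.time_bind, Timed.time_pure] <;> omega

theorem maxT_time (l : List (Node n)) (mx : ℝ) : (maxT l mx).time = 2 * l.length + 1 := by
  induction l generalizing mx with
  | nil => rfl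
  | cons N l ih =>
    simp only [maxT, Timed.time_bind, time_tick, time_rmax, ih, List.length_cons]
    omega

theorem gridT_time (ρ θ x : ℝ) : (gridT ρ θ x).time = 6 * (gridT ρ θ x).ret.length + 5 := by
  induction hg : (gridT ρ θ x).ret generalizing x with
  | nil => rw [gridT, dif_neg (gridT_ret_eq_nil hg)]; rfl
  | cons g grid ih =>
    obtain ⟨hc, -, hg'⟩ := gridT_ret_eq_cons hg
    rw [gridT, dif_pos hc]
    simp only [ih _ hg', List.length_cons]
    omega

theorem betterT_time (best : Option (Node n)) (N : Node n) : (betterT best N).time = 1 := by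
  cases best with
  | none => rfl
  | some M =>
    simp only [betterT, Timed.time_bind, time_rle, ret_rle]
    split_ifs <;> rfl

/-- Amortized form: each consumed node pays three steps and the nodes left over are credited. Summed
over the buckets, the scan is linear in the list plus the grid. -/
theorem takeBucketT_time_le (g : ℝ) (best : Option (Node n)) (l : List (Node n)) :
    (takeBucketT g best l).time + 3 * (takeBucketT g best l).ret.2.length ≤
      3 * l.length + 2 := by
  induction l generalizing best with
  | nil => simp [takeBucketT]
  | cons N l ih =>
    simp only [takeBucketT, Timed.time_bind, Timed.ret_bind, time_tick, time_rle, ret_rle]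
    split_ifs
    · simp only [Timed.time_pure, Timed.ret_pure]
      omega
    · have := ih (some (betterT best N).ret)
      simp only [Timed.time_bind, Timed.ret_bind, betterT_time, List.length_cons] at this ⊢
      omega

theorem bucketsT_time_le (tail : List (Node n)) (grid : List ℝ) (l : List (Node n)) :
    (bucketsT tail grid l).time ≤ 3 * grid.length + 3 * l.length + 1 := by
  induction grid generalizing l with
  | nil => simp [bucketsT]
  | cons g grid ih =>
    have h1 := takeBucketT_time_le g none l
    have h2 := ih (takeBucketT g none l).ret.2
    have h3 : (bucketsT tail (g :: grid) l).time = 1 + ((takeBucketT g none l).time +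
        ((bucketsT tail grid (takeBucketT g none l).ret.2).time + 0)) := by
      simp only [bucketsT, Timed.time_bind, time_tick]
      cases (takeBucketT g none l).ret.1 <;> rfl
    rw [List.length_cons]
    omega

theorem bucketsT_length_le (tail : List (Node n)) (grid : List ℝ) (l : List (Node n)) :
    (bucketsT tail grid l).ret.length ≤ grid.length + tail.length := by
  induction grid generalizing l with
  | nil => simp [bucketsT]
  | cons g grid ih =>
    have h := ih (takeBucketT g none l).ret.2
    simp only [bucketsT, Timed.ret_bind]
    cases (takeBucketT g none l).ret.1 <;> simp only [Timed.ret_pure, List.length_cons] <;> omega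

theorem emptyBucketT_time_le (best : Option (Node n)) (l : List (Node n)) :
    (emptyBucketT best l).time ≤ 2 * l.length + 1 := by
  induction l generalizing best with
  | nil => cases best <;> simp [emptyBucketT]
  | cons N l ih =>
    cases hT : N.T with
    | nil =>
      have := ih (some (betterT best N).ret)
      cases best <;> simp only [emptyBucketT, hT, Timed.time_bind, time_tick, betterT_time,
        List.length_cons] at this ⊢ <;> omega
    | cons i T =>
      have := ih best
      cases best <;> simp only [emptyBucketT, hT, Timed.time_bind, time_tick,
        List.length_cons] at this ⊢ <;> omega

theorem emptyBucketT_length_le (l : List (Node n)) :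
    (emptyBucketT none l).ret.length ≤ 1 := by
  obtain ⟨o, -, h⟩ := emptyBucketT_spec none l
  rw [h]
  cases o <;> simp

theorem valueFromT_time (X : Fin n → ThreePoint) (l : List (Fin n)) (v : ℝ) :
    (valueFromT X l v).time = 11 * l.length + 1 := by
  induction l with
  | nil => rfl
  | cons i l ih =>
    simp only [valueFromT, Timed.time_bind, time_tick, expMaxT_time, ih, List.length_cons]
    omega

theorem bestT_time_le (X : Fin n → ThreePoint) (best : ℝ × SeqPair n) (L : List (Node n))
    (hL : ∀ N ∈ L, N.S.length ≤ n) :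
    (bestT X best L).time ≤ L.length * (11 * n + 3) + 1 := by
  induction L generalizing best with
  | nil => simp [bestT]
  | cons N L ih =>
    have h1 := hL N (by simp)
    have h2 := fun best => ih best fun M hM => hL M (by simp [hM])
    have e : (L.length + 1) * (11 * n + 3) = L.length * (11 * n + 3) + (11 * n + 3) := by ring
    simp only [bestT, Timed.time_bind, time_tick, valueFromT_time, time_rle, List.length_cons]
    split_ifs
    · have := h2 best
      omega
    · have := h2 ((valueFromT X N.S N.v).ret, (N.S, N.T))
      omega

/-! ## The size of the grid -/

/-- The last of `m + 1` grid points is `ρ ^ m * x`, and it passed the test against `θ`. -/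
theorem le_pow_mul_of_gridT_length {ρ θ x : ℝ} {m : ℕ}
    (h : (gridT ρ θ x).ret.length = m + 1) : θ ≤ ρ ^ m * x := by
  induction m generalizing x with
  | zero =>
    obtain ⟨g, grid, hg⟩ := List.exists_cons_of_length_eq_add_one h
    simpa using (gridT_ret_eq_cons hg).1.2.2.2
  | succ m ih =>
    obtain ⟨g, grid, hg⟩ := List.exists_cons_of_length_eq_add_one h
    have hg' := (gridT_ret_eq_cons hg).2.2
    rw [pow_succ, mul_assoc]
    refine ih ?_
    rw [hg', ← Nat.add_right_cancel_iff (n := 1), ← h, hg, List.length_cons]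

/-- A bound `(1 - δ) ^ m ≤ 1 / (1 + m δ)` without logarithms: Bernoulli bounds the first factor by
`(1 + δ) ^ m`, and `(1 + δ) (1 - δ) ≤ 1`. -/
theorem one_add_mul_mul_pow_le_one {δ : ℝ} (h0 : 0 ≤ δ) (h1 : δ ≤ 1) (m : ℕ) :
    (1 + m * δ) * (1 - δ) ^ m ≤ 1 := by
  calc (1 + m * δ) * (1 - δ) ^ m ≤ (1 + δ) ^ m * (1 - δ) ^ m :=
        mul_le_mul_of_nonneg_right (one_add_mul_le_pow (by linarith) m)
          (pow_nonneg (by linarith) m)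
    _ = (1 - δ ^ 2) ^ m := by rw [← mul_pow]; ring
    _ ≤ 1 := pow_le_one₀ (by nlinarith) (by nlinarith)

/-- A bound for the size of the grid. -/
noncomputable def gridBound (n : ℕ) (ε : ℝ) : ℕ := ⌊8 * (n : ℝ) ^ 2 / ε ^ 2⌋₊

/-- Let `δ = ε / (2 n)`. If there are `J > 0` grid points, the smallest gives `δ MAX ≤ 2 ρ ^ J MAX`
with `MAX > 0`. Together with `(1 + J δ) ρ ^ J ≤ 1` this yields `δ (1 + J δ) ≤ 2`, so `J ≤ 2 / δ² =
8 n² / ε²`. A logarithmic estimate would be sharper, but this one suffices. -/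
theorem gridT_length_le {X : Fin n → ThreePoint} {ε : ℝ} (hn : 1 ≤ n) (h0 : 0 < ε) (h1 : ε < 1)
    {mx : ℝ} (hmx : mx ≤ 2 * maxParam X) :
    (gridT (gridRatio n ε) (threshold X ε) (gridRatio n ε * mx)).ret.length ≤ gridBound n ε := by
  obtain ⟨hr0, hr1⟩ := gridRatio_bounds hn h0 h1
  rcases hlen : (gridT (gridRatio n ε) (threshold X ε) (gridRatio n ε * mx)).ret.length with _ | m
  · exact Nat.zero_le _
  · have hle := le_pow_mul_of_gridT_length hlen
    obtain ⟨g, grid, hg⟩ := List.exists_cons_of_length_eq_add_one hlen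
    have hθ := (gridT_ret_eq_cons hg).1.1
    have hn' : (1 : ℝ) ≤ n := by exact_mod_cast hn
    have hM : 0 < maxParam X := by
      refine (maxParam_nonneg hn X).lt_of_ne' fun h => ?_
      rw [threshold, h, mul_zero] at hθ
      exact lt_irrefl _ hθ
    rw [← mul_assoc, ← pow_succ] at hle
    have h2 := hle.trans (mul_le_mul_of_nonneg_left hmx (pow_nonneg hr0.le _))
    have hδ0 : 0 < ε / (2 * n) := by positivity
    have hδ1 : ε / (2 * n) ≤ 1 := (div_le_one (by linarith)).2 (by linarith)
    have h3 := one_add_mul_mul_pow_le_one hδ0.le hδ1 (m + 1)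
    have h4 : ε / (2 * n) ≤ 2 * gridRatio n ε ^ (m + 1) := by
      refine le_of_mul_le_mul_right ?_ hM
      rw [threshold] at h2
      linarith
    rw [gridRatio] at h4
    set δ := ε / (2 * n) with hδ
    have h5 : ((m + 1 : ℕ) : ℝ) * δ ^ 2 ≤ 2 := by
      have h6 := mul_le_mul_of_nonneg_left h4
        (by positivity : (0 : ℝ) ≤ 1 + ((m + 1 : ℕ) : ℝ) * δ)
      nlinarith
    refine Nat.le_floor ?_
    have h7 : 8 * (n : ℝ) ^ 2 / ε ^ 2 = 2 / δ ^ 2 := by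
      rw [hδ]
      field_simp
      norm_num
    rw [h7, le_div_iff₀ (by positivity)]
    exact h5

/-! ## Step counts of the main loop and of the whole program -/

/-- The number of steps of an iteration of the main loop. -/
noncomputable def loopStepTime (X : Fin n → ThreePoint) (ρ θ : ℝ) (k : Fin n)
    (L : List (Node n)) : ℕ :=
  1 + (mapT (pushS X k) L).time + (mapT (pushT X k) L).time +
    (mergeT (L.map fun N => (pushS X k N).ret) (L.map fun N => (pushT X k N).ret)).time +
    (trimT ρ θ (expandNodes X k L)).time

theorem loopT_cons_time (X : Fin n → ThreePoint) (ρ θ : ℝ) (k : Fin n) (ks : List (Fin n))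
    (L : List (Node n)) : (loopT X ρ θ (k :: ks) L).time =
      loopStepTime X ρ θ k L + (loopT X ρ θ ks (loopStep X ρ θ k L)).time := by
  simp only [loopT, Timed.time_bind, mapT_ret, time_tick]
  unfold loopStepTime loopStep expandNodes
  ring

theorem loopT_append_singleton_time (X : Fin n → ThreePoint) (ρ θ : ℝ) (ks : List (Fin n))
    (k : Fin n) (L : List (Node n)) :
    (loopT X ρ θ (ks ++ [k]) L).time =
      (loopT X ρ θ ks L).time + loopStepTime X ρ θ k (loopT X ρ θ ks L).ret := by
  induction ks generalizing L with
  | nil => exact (loopT_cons_time X ρ θ k [] L).trans (Nat.add_comm _ _)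
  | cons i ks ih =>
    rw [List.cons_append, loopT_cons_time, loopT_cons_time, ih, loopT_cons_ret, Nat.add_assoc]

theorem trimT_time_le {X : Fin n → ThreePoint} {ε : ℝ} (hn : 1 ≤ n) (h0 : 0 < ε) (h1 : ε < 1)
    {M : List (Node n)} (hM : ∀ N ∈ M, N.v ≤ 2 * maxParam X) :
    (trimT (gridRatio n ε) (threshold X ε) M).time ≤ 7 * M.length + 9 * gridBound n ε + 9 ∧
      (trimT (gridRatio n ε) (threshold X ε) M).ret.length ≤ gridBound n ε + 1 := by
  have hmx : (maxT M 0).ret ≤ 2 * maxParam X := by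
    rcases (maxT_spec M 0).2.2 with h | ⟨N, hN, h⟩
    · rw [h]
      linarith [maxParam_nonneg hn X]
    · exact h.trans_le (hM N hN)
  have h2 := gridT_length_le hn h0 h1 hmx
  set grid := (gridT (gridRatio n ε) (threshold X ε) (gridRatio n ε * (maxT M 0).ret)).ret with hgrid
  have h3 := bucketsT_time_le (emptyBucketT none M).ret grid M
  have h4 := bucketsT_length_le (emptyBucketT none M).ret grid M
  have h5 := emptyBucketT_length_le M
  have h6 := emptyBucketT_time_le none M
  simp only [trimT, Timed.time_bind, Timed.ret_bind, ret_rmul, time_rmul, maxT_time, gridT_time,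
    ← hgrid]
  constructor <;> omega

/-- Per node of `L`, the two maps cost `5` and `11` steps, the merge `4`, and trimming the doubled
list `14`, which makes `34`. -/
theorem NodesGood.loopStep_time {X : Fin n → ThreePoint} {ε : ℝ} (hn : 1 ≤ n) (h0 : 0 < ε)
    (h1 : ε < 1) {o t : List (Fin n)} {k : Fin n} {L : List (Node n)} (h : NodesGood X o L)
    (ho : (t ++ k :: o).Perm (List.finRange n)) :
    loopStepTime X (gridRatio n ε) (threshold X ε) k L ≤
        34 * L.length + 9 * gridBound n ε + 13 ∧
      (OptimalOrdering.loopStep X (gridRatio n ε) (threshold X ε) k L).length ≤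
        gridBound n ε + 1 := by
  have hg := h.expandNodes k
  have hv : ∀ N ∈ OptimalOrdering.expandNodes X k L, N.v ≤ 2 * maxParam X := by
    intro N hN
    rw [(hg.valid N hN).v_eq]
    exact seqValue_le_maxParam hn X ho
      ((hg.sublist N hN).trans (List.sublist_append_right _ _))
  obtain ⟨h2, h3⟩ := trimT_time_le hn h0 h1 hv
  have h4 := mapT_time_le (pushS X k) (c := 4) L fun _ _ => le_rfl
  have h5 := mapT_time_le (pushT X k) (c := 10) L fun _ _ => le_rfl
  have h6 := mergeT_time_le (L.map fun N => (pushS X k N).ret) (L.map fun N => (pushT X k N).ret)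
  have h7 : (OptimalOrdering.expandNodes X k L).length = 2 * L.length := by
    rw [OptimalOrdering.expandNodes, (mergeT_perm _ _).length_eq, List.length_append,
      List.length_map, List.length_map]
    ring
  rw [h7] at h2
  rw [List.length_map, List.length_map] at h6
  refine ⟨?_, h3⟩
  unfold loopStepTime
  omega

theorem nodesAt_length_le {X : Fin n → ThreePoint} {ε : ℝ} (hn : 1 ≤ n) (h0 : 0 < ε)
    (h1 : ε < 1) (π : Equiv.Perm (Fin n)) (k : ℕ) (hk : k ≤ n) :
    (nodesAt X ε π k).length ≤ gridBound n ε + 1 := by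
  cases k with
  | zero =>
    have h : nodesAt X ε π 0 = [⟨[], [], 0, 0⟩] := rfl
    simp [h]
  | succ k =>
    have e2 := nodesAt_succ X ε π ⟨k, hk⟩
    have e3 := drop_append_processed_perm π (k + 1)
    have e1 := processed_succ π ⟨k, hk⟩
    simp only at e1 e2
    rw [e1] at e3
    rw [e2]
    exact ((nodesAt_good hn h0 h1 π k (by omega)).loopStep_time hn h0 h1 e3).2

theorem loopT_time_le {X : Fin n → ThreePoint} {ε : ℝ} (hn : 1 ≤ n) (h0 : 0 < ε)
    (h1 : ε < 1) (π : Equiv.Perm (Fin n)) (k : ℕ) (hk : k ≤ n) :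
    (loopT X (gridRatio n ε) (threshold X ε) ((List.ofFn π).take k) [⟨[], [], 0, 0⟩]).time ≤
      k * (43 * gridBound n ε + 47) + 1 := by
  induction k with
  | zero => simp [loopT]
  | succ k ih =>
    have e1 := processed_succ π ⟨k, hk⟩
    have e3 := drop_append_processed_perm π (k + 1)
    simp only at e1
    rw [e1] at e3
    have h2 := ((nodesAt_good hn h0 h1 π k (by omega)).loopStep_time hn h0 h1 e3 (X := X)).1
    have h3 := nodesAt_length_le hn h0 h1 π k (by omega) (X := X)
    have h4 := ih (by omega)
    have h5 : (List.ofFn π).take (k + 1) = (List.ofFn π).take k ++ [π ⟨k, hk⟩] := by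
      rw [List.take_add_one]
      simp [Nat.lt_of_succ_le hk]
    rw [h5, loopT_append_singleton_time]
    rw [nodesAt] at h2 h3
    -- With at most `B + 1` nodes, where `B` is `gridBound n ε`, an iteration costs at most `34 (B +
    -- 1) + 9 B + 13 = 43 B + 47` steps.
    have e : (k + 1) * (43 * gridBound n ε + 47) =
      k * (43 * gridBound n ε + 47) + (43 * gridBound n ε + 47) := by ring
    omega

theorem step_bound_le {x B ε : ℝ} (hx : 1 ≤ x) (h0 : 0 < ε) (h1 : ε < 1) (hB0 : 0 ≤ B)
    (hB : B ≤ 8 * x ^ 2 / ε ^ 2) :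
    4 * x ^ 2 + 24 * x + 17 + x * (43 * B + 47) + (B + 1) * (11 * x + 3) ≤
      1000 * (x ^ 4 / ε ^ 2) := by
  -- With `Q = x² / ε²` every term is at most a multiple of `x² Q = x⁴ / ε²`, since `1 ≤ x ≤ x² ≤ Q`
  -- and `B ≤ 8 Q`. The multiples add up to less than `1000`.
  obtain ⟨Q, hQ⟩ : ∃ Q, Q = x ^ 2 / ε ^ 2 := ⟨_, rfl⟩
  have hB' : B ≤ 8 * Q := by rw [hQ, ← mul_div_assoc]; exact hB
  have hQ1 : x ^ 2 ≤ Q := by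
    rw [hQ, le_div_iff₀ (by positivity)]
    exact mul_le_of_le_one_right (by positivity) (pow_le_one₀ h0.le h1.le)
  have hQ4 : x ^ 4 / ε ^ 2 = x ^ 2 * Q := by rw [hQ]; ring
  rw [hQ4]
  have hn2 : x ≤ x ^ 2 := by nlinarith
  have hQn : 1 ≤ Q := by linarith
  have a1 : x * B ≤ x ^ 2 * (8 * Q) := mul_le_mul hn2 hB' hB0 (by positivity)
  have a2 : x ^ 2 ≤ x ^ 2 * Q := le_mul_of_one_le_right (by positivity) hQn
  have a3 : B ≤ x * B := le_mul_of_one_le_left hB0 hx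
  linarith

theorem fptas_time_le {X : Fin n → ThreePoint} {ε : ℝ} (hn : 1 ≤ n) (h0 : 0 < ε)
    (h1 : ε < 1) : ((fptas X ε).time : ℝ) ≤ 1000 * ((n : ℝ) ^ 4 / ε ^ 2) := by
  obtain ⟨π, hπ, -⟩ := exists_sorted_perm X
  have hgood := nodesAt_good hn h0 h1 (X := X) π n le_rfl
  have hp := (drop_append_processed_perm π n)
  rw [List.drop_eq_nil_of_le (by simp), List.nil_append] at hp
  have hS : ∀ N ∈ nodesAt X ε π n, N.S.length ≤ n := by
    intro N hN
    have h := ((hgood.perm N hN).trans hp).length_eq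
    rw [List.length_append, List.length_finRange] at h
    omega
  have t1 := sortByT_time_le (fun i => condMeanT (X i)) (List.finRange n)
    fun i => condMeanT_time (X i)
  rw [List.length_finRange] at t1
  have t2 := maxParamT_time_le X
  have t3 := loopT_time_le hn h0 h1 (X := X) π n le_rfl
  have t4 := bestT_time_le X (-1, ([], [])) (nodesAt X ε π n) hS
  have t5 := nodesAt_length_le hn h0 h1 (X := X) π n le_rfl
  have t6 : (bestT X (-1, ([], [])) (nodesAt X ε π n)).ret.1.length ≤ n := by
    obtain ⟨σ, hσ, -⟩ := fptas_isOutput hn h0 h1 (X := X)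
    rw [fptas_ret hn hπ] at hσ
    have := congrArg List.length hσ
    rw [List.length_append, List.length_ofFn] at this
    omega
  have htime : (fptas X ε).time =
      (sortByT (fun i => condMeanT (X i)) (List.finRange n)).time + (maxParamT X).time + 4 +
      (loopT X (gridRatio n ε) (threshold X ε) ((List.ofFn π).take n) [⟨[], [], 0, 0⟩]).time +
      (bestT X (-1, ([], [])) (nodesAt X ε π n)).time +
      ((bestT X (-1, ([], [])) (nodesAt X ε π n)).ret.1.length + 1) := by
    simp only [fptas, Timed.time_bind, appendT_time, ret_rmul, ret_rdiv,
      ret_rsub, maxParamT_ret hn, time_rmul, time_rdiv, time_rsub]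
    rw [nodesAt, List.take_of_length_le (by simp), hπ]
    unfold threshold gridRatio
    ring
  have t7 := Nat.mul_le_mul_right (11 * n + 3) t5
  have hnat : (fptas X ε).time ≤ 4 * n ^ 2 + 24 * n + 17 + n * (43 * gridBound n ε + 47) +
      (gridBound n ε + 1) * (11 * n + 3) := by
    rw [htime]
    omega
  have hB : (gridBound n ε : ℝ) ≤ 8 * (n : ℝ) ^ 2 / ε ^ 2 := Nat.floor_le (by positivity)
  have hreal : ((fptas X ε).time : ℝ) ≤ 4 * (n : ℝ) ^ 2 + 24 * n + 17 +
      n * (43 * gridBound n ε + 47) + (gridBound n ε + 1) * (11 * n + 3) := by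
    exact_mod_cast hnat
  exact hreal.trans (step_bound_le (by exact_mod_cast hn) h0 h1 (Nat.cast_nonneg _) hB)

end OptimalOrdering

theorem mainTheorem5 :
    ∃ C : ℝ, ∀ (n : ℕ) (_ : 1 ≤ n) (X : Fin n → ThreePoint) (ε : ℝ) (_ : 0 < ε) (_ : ε < 1),
      (∀ σ : Equiv.Perm (Fin n), IsOutput X ε σ → (1 - ε) * optValue X ≤ orderValue X σ) ∧
      (∃ σ : Equiv.Perm (Fin n), (fptas X ε).ret = List.ofFn σ ∧ IsOutput X ε σ) ∧
      ((fptas X ε).time : ℝ) ≤ C * ((n : ℝ) ^ 4 / ε ^ 2) :=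
  ⟨1000, fun _ hn _ _ h0 h1 => ⟨fun _ hσ => hσ.le_orderValue hn h0 h1,
    fptas_isOutput hn h0 h1, fptas_time_le hn h0 h1⟩⟩
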